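/- **Setting.** Let $d\ge 1$, let $\ell\ge 2$ be even, $\hat\ell\ge\ell$, $M\ge 1$. Let $\mathcal A(\xi)=\sum_{|\alpha|=\ell}b_\alpha\xi^\alpha$, $b_\alpha\in\mathbb C$, be strongly elliptic: $\operatorname{Re}\mathcal A(\xi)\ge c|\xi|^\ell$ for all $\xi\in\mathbb R^d$ with some $c>0$. For a polynomial $\mathcal P(\xi)=\sum_\alpha p_\alpha\xi^\alpha$ put $\mathcal P(\mathcal D)=\sum_\alpha p_\alpha\mathcal D_1^{\alpha_1}\cdots\mathcal D_d^{\alpha_d}$, where $\mathcal D_j=-i\,\partial/\partial y_j$. Let $$\mathbf A_\varepsilon=\varepsilon^{-\ell}\sum_{\ell\le|\nu|\le\hat\ell}a_\nu\,\delta_{\varepsilon,1-}^{\nu_1}\delta_{\varepsilon,1+}^{\nu_2}\cdots\delta_{\varepsilon,d-}^{\nu_{2d-1}}\delta_{\varepsilon,d+}^{\nu_{2d}},\qquad \delta_{\varepsilon,k\pm}u(y)=u(y\pm\varepsilon e_k)-u(y),\quad a_\nu\in\mathbb C .$$ Assume that $\mathbf A_\varepsilon$ is an $M$-th order approximation of $\mathcal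 A(\mathcal D)$: for every $u\in C^\infty(\mathbb R^d;\mathbb C)$ that is bounded together with all its derivatives there is $C(u)>0$ with $\sup_{y\in\mathbb R^d}|\mathbf A_\varepsilon u(y)-\mathcal A(\mathcal D)u(y)|\le C(u)\varepsilon^M$ for all $\varepsilon>0$. Assume also that $\mathbf A_\varepsilon$ is elliptic: $\operatorname{Re}A(\theta)>0$ for all $\theta\in[-\pi,\pi]^d\setminus\{0\}$, where the symbol $A(\theta)$ is obtained from $\mathbf A_1$ by replacing each $\delta_{1,k\pm}$ by $e^{\pm i\theta_k}-1$. For $\varepsilon>0$ let $\mathbb R^d_\varepsilon=\varepsilon\mathbb Z^d$. The first discrete Green function $\mathbf u^\varepsilon(x,t)$, $x\in\mathbb R^d_\varepsilon$, $t\ge0$, is the function such that $\mathbf u^\varepsilon(\cdot,t)$ decays faster than any negative power of $|x|$ for each $t\ge 0$, $\mathbf u^\varepsilon(x,\cdot)\in C^1[0,\infty)$ for each $x$, $\partial_t\mathbf u^\varepsilon+\mathbf A_\varepsilon\mathbf u^\varepsilon=0$ for $t>0$, $\mathbf u^\varepsilon(0,0)=\varepsilon^{-d}$, and $\mathbf u^\varepsilon(x,0)=0$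 for $x\ne0$. Let $$H(y)=\frac1{(2\pi)^d}\int_{\mathbb R^d}e^{-\mathcal A(\xi)}e^{iy\cdot\xi}\,d\xi .$$ Let $\mathcal A_{n}(\xi)$ be the homogeneous part of degree $n$ of the Taylor series of $A$ at $0$, let $S(z)=\sum_{k\ge0}\mathcal A_{k+\ell}(\xi)z^k$ (a formal power series in $z$), let $\mathcal R_{J,k}(\xi)$ be the coefficient of $z^k$ in $(-S(z))^J e^{S(0)-S(z)}$, and let $H_{Jk}=\mathcal R_{J,k}(\mathcal D)H$, a finite linear combination of derivatives of $H$. **Theorem.** The function $H$ is of class $C^\infty$; for all $J\ge0$ we have $H_{J0}=(-\mathcal A(\mathcal D))^JH$ and $H_{Jk}=0$ for $0<k<M$. For every $\varepsilon>0$ the first discrete Green function exists, is unique, and is of class $C^\infty$ in $t\in[0,\infty)$ for each $x$. For all integers $K\ge M$, $J\ge0$ and every $t_0>0$ there is a constant $R=R(J,K,t_0)\ge0$ such that for all $\varepsilon>0$, $x\in\mathbb R^d_\varepsilon$ and $t\ge t_0\varepsilon^\ell$ $$\left|\frac{\partial^J\mathbf u^\varepsilon(x,t)}{\partial t^J}-\sum_{k=0}^K\frac{\varepsilon^k}{t^{(k+d)/\ell+J}}\,H_{Jk}\!\left(\frac{x}{t^{1/\ell}}\right)\right|\le\frac{\varepsilon^{K+1}R}{t^{(K+d+1)/\ell+J}}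 .$$ Here $R$ does not depend on $\varepsilon$, $x$ and $t$. -/

import Mathlib

open scoped ContDiff

noncomputable section

/-! ### Differential operators with constant coefficients on `ℝ^d` -/

/-- `D_j = -i ∂/∂y_j`. -/
def partialD {d : ℕ} (j : Fin d) (f : EuclideanSpace ℝ (Fin d) → ℂ) :
    EuclideanSpace ℝ (Fin d) → ℂ :=
  fun y => -Complex.I * lineDeriv ℝ f y (EuclideanSpace.single j 1)

/-- `D^α = D_1^{α_1} ⋯ D_d^{α_d}`. -/
def multiD {d : ℕ} (α : Fin d →₀ ℕ) (f : EuclideanSpace ℝ (Fin d) → ℂ) :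
    EuclideanSpace ℝ (Fin d) → ℂ :=
  (List.finRange d).foldr (fun j g => (partialD j)^[α j] g) f

/-- The differential operator `P(D) = ∑_α b_α D^α` with symbol `P(ξ) = ∑_α b_α ξ^α`. -/
def diffOp {d : ℕ} (P : MvPolynomial (Fin d) ℂ) (f : EuclideanSpace ℝ (Fin d) → ℂ) :
    EuclideanSpace ℝ (Fin d) → ℂ :=
  fun y => ∑ α ∈ P.support, P.coeff α * multiD α f y

/-- The value `P(ξ)` of a symbol at a real point. -/
def symbolAt {d : ℕ} (P : MvPolynomial (Fin d) ℂ) (ξ : EuclideanSpace ℝ (Fin d)) : ℂ :=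
  MvPolynomial.eval (fun j => (ξ j : ℂ)) P

/-- Strong ellipticity of order `l`: `Re P(ξ) ≥ c |ξ|^l` with some `c > 0`. -/
def IsStronglyElliptic {d : ℕ} (l : ℕ) (P : MvPolynomial (Fin d) ℂ) : Prop :=
  ∃ c : ℝ, 0 < c ∧ ∀ ξ : EuclideanSpace ℝ (Fin d), c * ‖ξ‖ ^ l ≤ (symbolAt P ξ).re

/-- The continuous Green profile `H(y) = (2π)^{-d} ∫ e^{-P(ξ)} e^{i y·ξ} dξ`. -/
def greenProfile {d : ℕ} (P : MvPolynomial (Fin d) ℂ) (y : EuclideanSpace ℝ (Fin d)) : ℂ :=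
  ((2 * Real.pi : ℝ) : ℂ)⁻¹ ^ d *
    ∫ ξ : EuclideanSpace ℝ (Fin d),
      Complex.exp (-symbolAt P ξ) * Complex.exp (Complex.I * ((inner ℝ y ξ : ℝ) : ℂ))

/-- Smooth functions: all derivatives exist and are continuous and bounded on `ℝ^d`. -/
def IsSmoothBounded {d : ℕ} (u : EuclideanSpace ℝ (Fin d) → ℂ) : Prop :=
  ContDiff ℝ ∞ u ∧ ∀ n : ℕ, ∃ C : ℝ, ∀ y, ‖iteratedFDeriv ℝ n u y‖ ≤ C

/-! ### Difference operators

The coefficients `a_ν` of a difference operator form a polynomial `a` in the `2d` variables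
`(k, false)`, standing for the backward difference `δ_{k-}`, and `(k, true)`, standing for the
forward difference `δ_{k+}`. -/

/-- The operator `ε^{-l} ∑_ν a_ν δ_{1-}^{ν_1} δ_{1+}^{ν_2} ⋯ δ_{d-}^{ν_{2d-1}} δ_{d+}^{ν_{2d}}`,
where `δ_{k±} u(y) = u(y ± e_k) - u(y)` and `e_k` is the step in the `k`-th direction. -/
def differenceOp {d : ℕ} {G : Type*} [AddCommGroup G] (l : ℕ)
    (a : MvPolynomial (Fin d × Bool) ℂ) (ε : ℝ) (e : Fin d → G) (u : G → ℂ) : G → ℂ :=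
  fun y => (((ε ^ l)⁻¹ : ℝ) : ℂ) * ∑ ν ∈ a.support, a.coeff ν *
    (List.finRange d).foldr
      (fun k f => (fwdDiff (-e k))^[ν (k, false)] ((fwdDiff (e k))^[ν (k, true)] f)) u y

/-- The difference operator acting on functions on `ℝ^d`, with steps `ε e_k`. -/
def differenceOpSpace {d : ℕ} (l : ℕ) (a : MvPolynomial (Fin d × Bool) ℂ) (ε : ℝ)
    (u : EuclideanSpace ℝ (Fin d) → ℂ) : EuclideanSpace ℝ (Fin d) → ℂ :=
  differenceOp l a ε (fun k => EuclideanSpace.single k ε) u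

/-- The difference operator acting on grid functions. A function on the grid
`{x ∈ ℝ^d : x_k = ε s_k, s_k ∈ ℤ}` is written as a function of `s ∈ ℤ^d`. -/
def differenceOpGrid {d : ℕ} (l : ℕ) (a : MvPolynomial (Fin d × Bool) ℂ) (ε : ℝ)
    (u : (Fin d → ℤ) → ℂ) : (Fin d → ℤ) → ℂ :=
  differenceOp l a ε (fun k => Pi.single k 1) u

/-- The difference operator is an `M`-th order approximation of `P(D)`. -/
def IsApproximation {d : ℕ} (l : ℕ) (a : MvPolynomial (Fin d × Bool) ℂ)
    (P : MvPolynomial (Fin d) ℂ) (M : ℕ) : Prop :=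
  ∀ u : EuclideanSpace ℝ (Fin d) → ℂ, IsSmoothBounded u →
    ∃ C : ℝ, 0 < C ∧ ∀ ε : ℝ, 0 < ε → ∀ y : EuclideanSpace ℝ (Fin d),
      ‖differenceOpSpace l a ε u y - diffOp P u y‖ ≤ C * ε ^ M

/-- `-i` for the backward and `i` for the forward difference. -/
def signI (b : Bool) : ℂ := if b then Complex.I else -Complex.I

/-- The symbol `A(θ)`, obtained from the operator with `ε = 1` by `δ_{k±} ↦ e^{± i θ_k} - 1`. -/
def discreteSymbol {d : ℕ} (a : MvPolynomial (Fin d × Bool) ℂ) (θ : Fin d → ℝ) : ℂ :=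
  MvPolynomial.eval (fun p : Fin d × Bool => Complex.exp (signI p.2 * (θ p.1 : ℂ)) - 1) a

/-- `Re A(θ) > 0` for all nonzero `θ` in the cube `[-π, π]^d`. -/
def IsDiscreteElliptic {d : ℕ} (a : MvPolynomial (Fin d × Bool) ℂ) : Prop :=
  ∀ θ : Fin d → ℝ, (∀ k, |θ k| ≤ Real.pi) → θ ≠ 0 → 0 < (discreteSymbol a θ).re

/-! ### The first discrete Green function -/

/-- The point `x = ε s` of the grid. -/
def gridPoint {d : ℕ} (ε : ℝ) (s : Fin d → ℤ) : EuclideanSpace ℝ (Fin d) :=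
  WithLp.toLp 2 (fun k => ε * (s k : ℝ))

/-- A grid function that decays faster than any negative power of `|x|`. -/
def IsRapidlyDecreasing {d : ℕ} (ε : ℝ) (u : (Fin d → ℤ) → ℂ) : Prop :=
  ∀ N : ℕ, ∃ C : ℝ, ∀ s, ‖gridPoint ε s‖ ^ N * ‖u s‖ ≤ C

/-- `u` (with `u s t` the value at `x = ε s` and time `t ≥ 0`) is a first discrete Green function:
it solves `∂u/∂t + A_ε u = 0` for `t > 0` with the grid delta-function as initial value. -/
structure IsFirstGreen {d : ℕ} (l : ℕ) (a : MvPolynomial (Fin d × Bool) ℂ) (ε : ℝ)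
    (u : (Fin d → ℤ) → ℝ → ℂ) : Prop where
  rapid : ∀ t : ℝ, 0 ≤ t → IsRapidlyDecreasing ε (fun s => u s t)
  smooth : ∀ s, ContDiffOn ℝ 1 (u s) (Set.Ici 0)
  equation : ∀ s, ∀ t : ℝ, 0 < t →
    deriv (u s) t + differenceOpGrid l a ε (fun s' => u s' t) s = 0
  initial : ∀ s, u s 0 = if s = 0 then (((ε ^ d)⁻¹ : ℝ) : ℂ) else 0

/-! ### The coefficients of the expansion -/

/-- The Taylor series of `A(zθ)` in powers of `z`; its coefficients are polynomials in
`θ_1, …, θ_d`, the one at `z^n` being the homogeneous part `A_n(θ)` of degree `n` of `A(θ)`. -/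
def symbolSeries {d : ℕ} (a : MvPolynomial (Fin d × Bool) ℂ) :
    PowerSeries (MvPolynomial (Fin d) ℂ) :=
  MvPolynomial.aeval (fun p : Fin d × Bool =>
    PowerSeries.rescale (MvPolynomial.C (signI p.2) * MvPolynomial.X p.1)
      (PowerSeries.exp (MvPolynomial (Fin d) ℂ)) - 1) a

/-- The series `S(z) = z^{-l} A(zξ) = ∑_k A_{k+l}(ξ) z^k`. -/
def scaledSeries {d : ℕ} (l : ℕ) (a : MvPolynomial (Fin d × Bool) ℂ) :
    PowerSeries (MvPolynomial (Fin d) ℂ) :=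
  PowerSeries.mk fun k => PowerSeries.coeff (k + l) (symbolSeries a)

/-- The polynomial `R_{J,k}(ξ)`: the coefficient of `z^k` in `(-S(z))^J exp(S(0) - S(z))`.
As `S(0) - S(z)` has no constant term, the exponential series may be cut off after `m = k`. -/
def expansionPoly {d : ℕ} (l : ℕ) (a : MvPolynomial (Fin d × Bool) ℂ) (J k : ℕ) :
    MvPolynomial (Fin d) ℂ :=
  PowerSeries.coeff k ((-scaledSeries l a) ^ J *
    ∑ m ∈ Finset.range (k + 1), ((m.factorial : ℂ)⁻¹) •
      (PowerSeries.C (PowerSeries.coeff 0 (scaledSeries l a)) - scaledSeries l a) ^ m)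

/-- `H_{Jk} = R_{J,k}(D) H`. -/
def expansionTerm {d : ℕ} (l : ℕ) (a : MvPolynomial (Fin d × Bool) ℂ)
    (P : MvPolynomial (Fin d) ℂ) (J k : ℕ) : EuclideanSpace ℝ (Fin d) → ℂ :=
  diffOp (expansionPoly l a J k) (greenProfile P)

end

/-! ### Asymptotic expansions in a small parameter, with remainders of polynomial growth. -/

noncomputable section

/-! ### The remainder of the exponential series -/

/-! On the Fourier side the Green function is `(2πε)^{-d} ∫ exp(-t ε^{-l} A(θ)) e^{i s·θ} dθ` over
the cube `[-π, π]^d`. Put `τ = t^{1/l}`, `z = ε/τ` and `θ = zξ`. Up to the factor `τ^{-d} t^{-J}`,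
its `J`-th time derivative becomes the integral of `(-S_z)^J exp(-S_z)` over the cube enlarged by
`1/z`, where `S_z(ξ) = z^{-l} A(zξ)`. Since `t ≥ t₀ ε^l`, the parameter `z` stays bounded, and the
claim is an expansion of this integral in powers of `z`, uniform in the phase.

Testing the approximation hypothesis on plane waves shows that all terms of the Taylor series of `A`
of degree below `l + M` vanish except the one of degree `l`, which is `P` (`coeff_symbolSeries`).
Hence `S_z = P + O(z)` with polynomial growth in `ξ`. Write `exp(-S_z) = exp(-P) exp(P - S_z)` and
cut the second exponential after `n` terms. The remainder is at most `|P - S_z|^n` times `max(e^{-Re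
P}, e^{-Re S_z})`, and both exponentials decay like `e^{-c|ξ|^l}`: the first by strong ellipticity,
the second on the enlarged cube by `exists_le_re_discreteSymbol`. Outside the enlarged cube `z(1 +
|ξ|) ≥ 1`, so the terms left there are also of order `z^n`. This is
`exists_norm_expansionRemainder_le`; integrating it gives the bound, since polynomials times
`e^{-P}` are the Fourier transforms of derivatives of `H`.

Uniqueness is subtle because decay is assumed at each time separately, without local uniformity in
time. The difference of two solutions is only pointwise bounded in time; the Baire category theorem
makes it bounded on short intervals (`IsBoundedEvolution.exists_bound`), after which a contraction
argument forces it to vanish. -/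

theorem norm_exp_sub_sum_le (n : ℕ) (x : ℂ) :
    ‖Complex.exp x - ∑ m ∈ Finset.range n, ((m.factorial : ℂ)⁻¹) * x ^ m‖ ≤
      ‖x‖ ^ n * max 1 (Real.exp x.re) := by
  induction n generalizing x with
  | zero => simp [Complex.norm_exp]
  | succ n ih =>
    -- Along the segment `t ↦ t x` the derivative of the remainder of order `n + 1` is `x` times the
    -- remainder of order `n`, so the mean value inequality closes the induction. Keeping `Re x` in
    -- the bound, rather than `|x|`, is essential for the later use with `x = P - S`.
    let f : ℝ → ℂ := fun t => Complex.exp (t * x) -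
      ∑ m ∈ Finset.range (n + 1), ((m.factorial : ℂ)⁻¹) * (t * x) ^ m
    let f' : ℝ → ℂ := fun t => x * (Complex.exp (t * x) -
      ∑ m ∈ Finset.range n, ((m.factorial : ℂ)⁻¹) * (t * x) ^ m)
    have hlin : ∀ t : ℝ, HasDerivAt (fun t : ℝ => (t : ℂ) * x) x t := fun t => by
      simpa using (Complex.ofRealCLM.hasDerivAt (x := t)).mul_const x
    have hder : ∀ t, HasDerivAt f (f' t) t := by
      intro t
      have h2 : HasDerivAt (fun t : ℝ =>
          ∑ m ∈ Finset.range (n + 1), ((m.factorial : ℂ)⁻¹) * ((t : ℂ) * x) ^ m)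
          (∑ m ∈ Finset.range (n + 1),
            ((m.factorial : ℂ)⁻¹) * (m * ((t : ℂ) * x) ^ (m - 1) * x)) t :=
        HasDerivAt.fun_sum fun m _ => ((hlin t).pow m).const_mul _
      have h3 := (hlin t).cexp.sub h2
      refine (HasDerivAt.congr_deriv h3 ?_ :)
      show _ = x * (_ - _)
      symm
      rw [mul_sub, Finset.mul_sum, Finset.sum_range_succ', mul_comm x]
      congr 1
      simp only [Nat.cast_zero, zero_mul, mul_zero, add_zero]
      refine Finset.sum_congr rfl fun m _ => ?_
      have : ((m : ℂ) + 1) ≠ 0 := by exact_mod_cast Nat.succ_ne_zero m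
      have h4 : (m.factorial : ℂ) ≠ 0 := by exact_mod_cast m.factorial_ne_zero
      rw [Nat.factorial_succ]
      push_cast
      field_simp
    have hb : ∀ t ∈ Set.Ico (0 : ℝ) 1, ‖f' t‖ ≤ ‖x‖ ^ (n + 1) * max 1 (Real.exp x.re) := by
      intro t ht
      have h1 := ih (t * x)
      have h2 : ‖(t : ℂ) * x‖ ≤ ‖x‖ := by
        rw [norm_mul, Complex.norm_real, Real.norm_of_nonneg ht.1]
        exact mul_le_of_le_one_left (norm_nonneg _) ht.2.le
      have h3 : Real.exp ((t : ℂ) * x).re ≤ max 1 (Real.exp x.re) := by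
        rw [Complex.re_ofReal_mul]
        rcases le_total 0 x.re with h | h
        · exact le_max_of_le_right
            (Real.exp_le_exp.2 (mul_le_of_le_one_left h ht.2.le))
        · exact le_max_of_le_left
            (Real.exp_le_one_iff.2 (mul_nonpos_of_nonneg_of_nonpos ht.1 h))
      have h4 : max 1 (Real.exp ((t : ℂ) * x).re) ≤ max 1 (Real.exp x.re) :=
        max_le (le_max_left _ _) h3
      calc ‖f' t‖ ≤ ‖x‖ * (‖(t : ℂ) * x‖ ^ n * max 1 (Real.exp ((t : ℂ) * x).re)) := by
            rw [norm_mul]; gcongr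
        _ ≤ ‖x‖ * (‖x‖ ^ n * max 1 (Real.exp x.re)) := by gcongr
        _ = _ := by ring
    have h := norm_image_sub_le_of_norm_deriv_right_le_segment
      (fun t _ => (hder t).continuousAt.continuousWithinAt)
      (fun t _ => (hder t).hasDerivWithinAt) hb 1 (by simp)
    have h0 : f 0 = 0 := by simp [f, Finset.sum_range_succ']
    have h1 : f 1 = Complex.exp x - ∑ m ∈ Finset.range (n + 1), ((m.factorial : ℂ)⁻¹) * x ^ m := by
      simp [f]
    rw [h0, h1] at h
    simpa using h

/-! ### Functions bounded by a power of the parameter and polynomially in the frequency -/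

/-- `|f z ξ| ≤ C z^K (1 + |ξ|)^N` for `0 < z ≤ z₁` and all `ξ`. -/
def IsPolyO {d : ℕ} (z₁ : ℝ) (K : ℕ) (f : ℝ → (Fin d → ℝ) → ℂ) : Prop :=
  ∃ (C : ℝ) (N : ℕ), 0 ≤ C ∧ ∀ z, 0 < z → z ≤ z₁ → ∀ ξ, ‖f z ξ‖ ≤ C * z ^ K * (1 + ‖ξ‖) ^ N

namespace IsPolyO

variable {d : ℕ} {z₁ : ℝ} {K L : ℕ} {f g : ℝ → (Fin d → ℝ) → ℂ}

theorem congr (hf : IsPolyO z₁ K f) (h : ∀ z, 0 < z → z ≤ z₁ → ∀ ξ, f z ξ = g z ξ) :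
    IsPolyO z₁ K g := by
  obtain ⟨C, N, hC, hf⟩ := hf
  exact ⟨C, N, hC, fun z hz hz1 ξ => by rw [← h z hz hz1 ξ]; exact hf z hz hz1 ξ⟩

theorem add (hf : IsPolyO z₁ K f) (hg : IsPolyO z₁ K g) :
    IsPolyO z₁ K (fun z ξ => f z ξ + g z ξ) := by
  obtain ⟨C, N, hC, hf⟩ := hf
  obtain ⟨C', N', hC', hg⟩ := hg
  refine ⟨C + C', N + N', by positivity, fun z hz hz1 ξ => ?_⟩
  have h1 : 1 ≤ 1 + ‖ξ‖ := by linarith [norm_nonneg ξ]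
  have hN : (1 + ‖ξ‖) ^ N ≤ (1 + ‖ξ‖) ^ (N + N') := pow_le_pow_right₀ h1 (by omega)
  have hN' : (1 + ‖ξ‖) ^ N' ≤ (1 + ‖ξ‖) ^ (N + N') := pow_le_pow_right₀ h1 (by omega)
  calc ‖f z ξ + g z ξ‖ ≤ C * z ^ K * (1 + ‖ξ‖) ^ N + C' * z ^ K * (1 + ‖ξ‖) ^ N' :=
        norm_add_le_of_le (hf z hz hz1 ξ) (hg z hz hz1 ξ)
    _ ≤ C * z ^ K * (1 + ‖ξ‖) ^ (N + N') + C' * z ^ K * (1 + ‖ξ‖) ^ (N + N') := by gcongr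
    _ = _ := by ring

theorem mul (hf : IsPolyO z₁ K f) (hg : IsPolyO z₁ L g) :
    IsPolyO z₁ (K + L) (fun z ξ => f z ξ * g z ξ) := by
  obtain ⟨C, N, hC, hf⟩ := hf
  obtain ⟨C', N', hC', hg⟩ := hg
  refine ⟨C * C', N + N', by positivity, fun z hz hz1 ξ => ?_⟩
  rw [norm_mul]
  calc ‖f z ξ‖ * ‖g z ξ‖ ≤ (C * z ^ K * (1 + ‖ξ‖) ^ N) * (C' * z ^ L * (1 + ‖ξ‖) ^ N') :=
        mul_le_mul (hf z hz hz1 ξ) (hg z hz hz1 ξ) (norm_nonneg _)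
          ((norm_nonneg _).trans (hf z hz hz1 ξ))
    _ = _ := by ring

theorem mono (hf : IsPolyO z₁ K f) (h : L ≤ K) : IsPolyO z₁ L f := by
  obtain ⟨C, N, hC, hf⟩ := hf
  -- No sign is assumed for `z₁`, so the constant is clipped at `0` to stay nonnegative.
  refine ⟨C * z₁ ^ (K - L) ⊔ 0, N, le_max_right _ _, fun z hz hz1 ξ => (hf z hz hz1 ξ).trans ?_⟩
  have h2 : z ^ K = z ^ (K - L) * z ^ L := by rw [← pow_add]; congr 1; omega
  have h3 : z ^ (K - L) ≤ z₁ ^ (K - L) := pow_le_pow_left₀ hz.le hz1 _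
  rw [h2, ← mul_assoc]
  gcongr
  exact le_max_of_le_left (by gcongr)

theorem const (c : ℂ) : IsPolyO z₁ 0 (fun _ (_ : Fin d → ℝ) => c) :=
  ⟨‖c‖, 0, norm_nonneg _, fun z _ _ ξ => by simp⟩

theorem zero : IsPolyO z₁ K (fun _ (_ : Fin d → ℝ) => (0 : ℂ)) :=
  ⟨0, 0, le_rfl, fun z _ _ ξ => by simp⟩

theorem const_mul (c : ℂ) (hf : IsPolyO z₁ K f) : IsPolyO z₁ K (fun z ξ => c * f z ξ) := by
  simpa using (const c).mul hf

theorem neg (hf : IsPolyO z₁ K f) : IsPolyO z₁ K (fun z ξ => -f z ξ) := by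
  simpa using const_mul (-1) hf

theorem sub (hf : IsPolyO z₁ K f) (hg : IsPolyO z₁ K g) :
    IsPolyO z₁ K (fun z ξ => f z ξ - g z ξ) := by
  simpa [sub_eq_add_neg] using hf.add hg.neg

theorem coord (j : Fin d) : IsPolyO z₁ 0 (fun _ ξ => (ξ j : ℂ)) :=
  ⟨1, 1, zero_le_one, fun z _ _ ξ => by
    simpa using (norm_le_pi_norm ξ j).trans (by linarith)⟩

theorem zpow (K : ℕ) : IsPolyO z₁ K (fun z (_ : Fin d → ℝ) => (z : ℂ) ^ K) :=
  ⟨1, 0, zero_le_one, fun z hz _ ξ => by simp [abs_of_pos hz]⟩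

theorem sum {ι : Type*} (s : Finset ι) {f : ι → ℝ → (Fin d → ℝ) → ℂ}
    (hf : ∀ i ∈ s, IsPolyO z₁ K (f i)) : IsPolyO z₁ K (fun z ξ => ∑ i ∈ s, f i z ξ) := by
  classical
  induction s using Finset.induction_on with
  | empty => simpa using zero
  | insert i s hi ih =>
    simp only [Finset.sum_insert hi]
    exact (hf i (by simp)).add (ih fun j hj => hf j (by simp [hj]))

theorem pow (hf : IsPolyO z₁ K f) (n : ℕ) : IsPolyO z₁ (K * n) (fun z ξ => f z ξ ^ n) := by
  induction n with
  | zero => simpa using const 1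
  | succ n ih => simpa [pow_succ, mul_add] using ih.mul hf

theorem eval (p : MvPolynomial (Fin d) ℂ) :
    IsPolyO z₁ 0 (fun _ ξ => MvPolynomial.eval (fun j => (ξ j : ℂ)) p) := by
  induction p using MvPolynomial.induction_on with
  | C c => simpa using const c
  | add p q hp hq => simpa using hp.add hq
  | mul_X p j hp => simpa using hp.mul (coord j)

end IsPolyO

/-! ### Asymptotic expansions in powers of the parameter -/

/-- The sum of the terms of degree less than `K` of a power series. -/
def truncEval {d : ℕ} (F : PowerSeries (MvPolynomial (Fin d) ℂ)) (K : ℕ) (z : ℝ)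
    (ξ : Fin d → ℝ) : ℂ :=
  ∑ k ∈ Finset.range K, (z : ℂ) ^ k *
    MvPolynomial.eval (fun j => (ξ j : ℂ)) (PowerSeries.coeff k F)

/-- `F` is an asymptotic expansion of `f` in powers of `z`, with remainders of polynomial growth. -/
def HasExpansion {d : ℕ} (z₁ : ℝ) (f : ℝ → (Fin d → ℝ) → ℂ)
    (F : PowerSeries (MvPolynomial (Fin d) ℂ)) : Prop :=
  ∀ K, IsPolyO z₁ K (fun z ξ => f z ξ - truncEval F K z ξ)

namespace HasExpansion

variable {d : ℕ} {z₁ : ℝ} {f g : ℝ → (Fin d → ℝ) → ℂ}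
  {F G : PowerSeries (MvPolynomial (Fin d) ℂ)}

theorem isPolyO (hf : HasExpansion z₁ f F) : IsPolyO z₁ 0 f := by
  simpa [truncEval] using hf 0

theorem add (hf : HasExpansion z₁ f F) (hg : HasExpansion z₁ g G) :
    HasExpansion z₁ (fun z ξ => f z ξ + g z ξ) (F + G) := by
  refine fun K => ((hf K).add (hg K)).congr fun z _ _ ξ => ?_
  simp only [truncEval, map_add, mul_add, Finset.sum_add_distrib]
  ring

/-- Telescoping with complementary orders: `fg - (FG)_K = (f - F_K) g + ∑_{i<K} z^i F_i (g -
G_{K-i})`, where each summand is of order `z^K`. -/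
theorem mul (hf : HasExpansion z₁ f F) (hg : HasExpansion z₁ g G) :
    HasExpansion z₁ (fun z ξ => f z ξ * g z ξ) (F * G) := by
  intro K
  have h1 : IsPolyO z₁ K (fun z ξ => (f z ξ - truncEval F K z ξ) * g z ξ) := (hf K).mul hg.isPolyO
  have h2 : IsPolyO z₁ K (fun z ξ => ∑ i ∈ Finset.range K, ((z : ℂ) ^ i *
      MvPolynomial.eval (fun j => (ξ j : ℂ)) (PowerSeries.coeff i F)) *
        (g z ξ - truncEval G (K - i) z ξ)) := by
    refine IsPolyO.sum _ fun i hi => ?_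
    have := ((IsPolyO.zpow (d := d) (z₁ := z₁) i).mul
      (IsPolyO.eval (PowerSeries.coeff i F))).mul (hg (K - i))
    rwa [add_zero, Nat.add_sub_cancel' (Finset.mem_range.1 hi).le] at this
  refine (h1.add h2).congr fun z _ _ ξ => ?_
  have h3 : truncEval (F * G) K z ξ = ∑ i ∈ Finset.range K, ((z : ℂ) ^ i *
      MvPolynomial.eval (fun j => (ξ j : ℂ)) (PowerSeries.coeff i F)) *
        truncEval G (K - i) z ξ := by
    simp only [truncEval, Finset.mul_sum]
    rw [← Finset.sum_range_diag_flip]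
    refine Finset.sum_congr rfl fun m _ => ?_
    rw [PowerSeries.coeff_mul, Finset.Nat.sum_antidiagonal_eq_sum_range_succ_mk, map_sum,
      Finset.mul_sum]
    refine Finset.sum_congr rfl fun k hk => ?_
    have hk' : k ≤ m := Nat.lt_succ_iff.1 (Finset.mem_range.1 hk)
    have h4 : (z : ℂ) ^ m = (z : ℂ) ^ k * (z : ℂ) ^ (m - k) := by
      rw [← pow_add, Nat.add_sub_cancel' hk']
    rw [h4, map_mul]
    ring
  rw [h3]
  simp only [mul_sub, Finset.sum_sub_distrib, ← Finset.sum_mul]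
  simp only [truncEval]
  ring

theorem C (p : MvPolynomial (Fin d) ℂ) :
    HasExpansion z₁ (fun _ ξ => MvPolynomial.eval (fun j => (ξ j : ℂ)) p) (PowerSeries.C p) := by
  intro K
  rcases K with _ | K
  · simpa [truncEval] using IsPolyO.eval p
  · refine IsPolyO.zero.congr fun z _ _ ξ => ?_
    simp [truncEval, Finset.sum_range_succ', PowerSeries.coeff_C]

theorem const (c : ℂ) :
    HasExpansion z₁ (fun _ (_ : Fin d → ℝ) => c) (PowerSeries.C (MvPolynomial.C c)) := by
  simpa using C (d := d) (z₁ := z₁) (MvPolynomial.C c)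

theorem const_smul (c : ℂ) (hf : HasExpansion z₁ f F) :
    HasExpansion z₁ (fun z ξ => c * f z ξ) (c • F) := by
  have h := (const (d := d) (z₁ := z₁) c).mul hf
  rwa [Algebra.smul_def, PowerSeries.algebraMap_apply, MvPolynomial.algebraMap_eq]

theorem neg (hf : HasExpansion z₁ f F) : HasExpansion z₁ (fun z ξ => -f z ξ) (-F) := by
  simpa using const_smul (-1) hf

theorem sub (hf : HasExpansion z₁ f F) (hg : HasExpansion z₁ g G) :
    HasExpansion z₁ (fun z ξ => f z ξ - g z ξ) (F - G) := by
  simpa [sub_eq_add_neg] using hf.add hg.neg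

theorem one : HasExpansion z₁ (fun _ (_ : Fin d → ℝ) => 1) 1 := by
  simpa using const (d := d) (z₁ := z₁) 1

theorem pow (hf : HasExpansion z₁ f F) (n : ℕ) :
    HasExpansion z₁ (fun z ξ => f z ξ ^ n) (F ^ n) := by
  induction n with
  | zero => simpa using one
  | succ n ih => simpa only [pow_succ] using ih.mul hf

theorem sum {ι : Type*} (s : Finset ι) {f : ι → ℝ → (Fin d → ℝ) → ℂ}
    {F : ι → PowerSeries (MvPolynomial (Fin d) ℂ)} (hf : ∀ i ∈ s, HasExpansion z₁ (f i) (F i)) :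
    HasExpansion z₁ (fun z ξ => ∑ i ∈ s, f i z ξ) (∑ i ∈ s, F i) := by
  classical
  induction s using Finset.induction_on with
  | empty => simpa using const (d := d) (z₁ := z₁) 0
  | insert i s hi ih =>
    simp only [Finset.sum_insert hi]
    exact (hf i (by simp)).add (ih fun j hj => hf j (by simp [hj]))

theorem aeval {σ : Type*} {f : σ → ℝ → (Fin d → ℝ) → ℂ}
    {F : σ → PowerSeries (MvPolynomial (Fin d) ℂ)} (hf : ∀ i, HasExpansion z₁ (f i) (F i))
    (p : MvPolynomial σ ℂ) :
    HasExpansion z₁ (fun z ξ => MvPolynomial.eval (fun i => f i z ξ) p)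
      (MvPolynomial.aeval F p) := by
  induction p using MvPolynomial.induction_on with
  | C c => simpa [PowerSeries.algebraMap_apply] using const (d := d) (z₁ := z₁) c
  | add p q hp hq => simpa using hp.add hq
  | mul_X p j hp => simpa using hp.mul (hf j)

/-- Dividing by `z^l` an expansion whose first `l` terms vanish. -/
theorem div_pow (hf : HasExpansion z₁ f F) (l : ℕ)
    (hF : ∀ n < l, PowerSeries.coeff n F = 0) :
    HasExpansion z₁ (fun z ξ => ((z : ℂ) ^ l)⁻¹ * f z ξ)
      (PowerSeries.mk fun k => PowerSeries.coeff (k + l) F) := by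
  intro K
  -- Division by `z^l` costs `l` orders, so the expansion is taken to order `l + K`.
  obtain ⟨C, N, hC, h⟩ := hf (l + K)
  refine ⟨C, N, hC, fun z hz hz1 ξ => ?_⟩
  have hz0 : (z : ℂ) ^ l ≠ 0 := pow_ne_zero _ (by exact_mod_cast hz.ne')
  have h1 : truncEval F (l + K) z ξ = (z : ℂ) ^ l *
      truncEval (PowerSeries.mk fun k => PowerSeries.coeff (k + l) F) K z ξ := by
    simp only [truncEval, Finset.sum_range_add, Finset.mul_sum, PowerSeries.coeff_mk]
    rw [Finset.sum_eq_zero, zero_add]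
    · exact Finset.sum_congr rfl fun k _ => by rw [pow_add, add_comm l k]; ring
    · intro n hn
      simp [hF n (Finset.mem_range.1 hn)]
  have h2 : ‖f z ξ - truncEval F (l + K) z ξ‖ ≤ _ := h z hz hz1 ξ
  rw [h1] at h2
  have h3 : ((z : ℂ) ^ l)⁻¹ * f z ξ -
      truncEval (PowerSeries.mk fun k => PowerSeries.coeff (k + l) F) K z ξ =
      ((z : ℂ) ^ l)⁻¹ * (f z ξ - (z : ℂ) ^ l *
        truncEval (PowerSeries.mk fun k => PowerSeries.coeff (k + l) F) K z ξ) := by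
    field_simp
  have h4 : ‖((z : ℂ) ^ l)⁻¹‖ = (z ^ l)⁻¹ := by simp [abs_of_pos hz]
  show ‖((z : ℂ) ^ l)⁻¹ * f z ξ - truncEval _ K z ξ‖ ≤ _
  rw [h3, norm_mul, h4]
  calc (z ^ l)⁻¹ * _ ≤ (z ^ l)⁻¹ * (C * z ^ (l + K) * (1 + ‖ξ‖) ^ N) := by gcongr
    _ = _ := by rw [pow_add]; field_simp

end HasExpansion

/-- The exponent is purely imaginary, so the Taylor remainder is at most `|zξ|^K` for every `ξ`,
with no exponential growth. The expansion of the symbol follows by algebra, as it is a polynomial in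
these exponentials. -/
theorem hasExpansion_exp {d : ℕ} (z₁ : ℝ) (p : Fin d × Bool) :
    HasExpansion z₁ (fun z ξ => Complex.exp (signI p.2 * ((z • ξ) p.1 : ℝ)))
      (PowerSeries.rescale (MvPolynomial.C (signI p.2) * MvPolynomial.X p.1)
        (PowerSeries.exp (MvPolynomial (Fin d) ℂ))) := by
  intro K
  refine ⟨1, K, zero_le_one, fun z hz _ ξ => ?_⟩
  have hs : ‖signI p.2‖ = 1 := by unfold signI; split <;> simp
  have hre : (signI p.2 * ((z • ξ) p.1 : ℝ)).re = 0 := by unfold signI; split <;> simp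
  have h := norm_exp_sub_sum_le K (signI p.2 * ((z • ξ) p.1 : ℝ))
  rw [hre] at h
  have h1 : truncEval (PowerSeries.rescale (MvPolynomial.C (signI p.2) * MvPolynomial.X p.1)
        (PowerSeries.exp (MvPolynomial (Fin d) ℂ))) K z ξ =
      ∑ m ∈ Finset.range K, ((m.factorial : ℂ)⁻¹) * (signI p.2 * ((z • ξ) p.1 : ℝ)) ^ m := by
    refine Finset.sum_congr rfl fun m _ => ?_
    rw [PowerSeries.coeff_rescale, PowerSeries.coeff_exp,
      IsScalarTower.algebraMap_apply ℚ ℂ (MvPolynomial (Fin d) ℂ), MvPolynomial.algebraMap_eq]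
    simp only [map_mul, map_pow, MvPolynomial.eval_C, MvPolynomial.eval_X, one_div, map_inv₀,
      map_natCast, Pi.smul_apply, smul_eq_mul, Complex.ofReal_mul]
    ring
  show ‖Complex.exp (signI p.2 * ((z • ξ) p.1 : ℝ)) - truncEval _ K z ξ‖ ≤ _
  rw [h1]
  refine h.trans ?_
  have h2 : ‖signI p.2 * (((z • ξ) p.1 : ℝ) : ℂ)‖ ≤ z * (1 + ‖ξ‖) := by
    rw [norm_mul, hs, one_mul, Complex.norm_real, Pi.smul_apply, smul_eq_mul, norm_mul,
      Real.norm_of_nonneg hz.le]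
    have := norm_le_pi_norm ξ p.1
    gcongr
    linarith
  simp only [Real.exp_zero, max_self, mul_one, one_mul]
  rw [← mul_pow]
  gcongr

theorem hasExpansion_discreteSymbol {d : ℕ} (z₁ : ℝ) (a : MvPolynomial (Fin d × Bool) ℂ) :
    HasExpansion z₁ (fun z ξ => discreteSymbol a (z • ξ)) (symbolSeries a) :=
  HasExpansion.aeval (fun p => (hasExpansion_exp z₁ p).sub HasExpansion.one) a

end

/-! ### Operators as multipliers, and the consequences of the approximation hypothesis for the
symbol. -/

noncomputable section

/-! ### Constant-coefficient operators acting as multipliers -/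

/-- Here `Φ` turns symbols into functions and `T` acts on symbols as multiplication by `m`. The
abstract form serves plane waves, Fourier integrals over `ℝ^d` and Fourier coefficients over the
cube alike. -/
theorem iterate_multiplier {𝒢 X : Type*} [Monoid 𝒢] {Φ : 𝒢 → X} {T : X → X} {m : 𝒢}
    (h : ∀ g, T (Φ g) = Φ (m * g)) (n : ℕ) (g : 𝒢) : T^[n] (Φ g) = Φ (m ^ n * g) := by
  induction n with
  | zero => simp
  | succ n ih => rw [Function.iterate_succ_apply', ih, h, pow_succ', mul_assoc]

theorem foldr_multiplier {ι 𝒢 X : Type*} [Monoid 𝒢] {Φ : 𝒢 → X} {T : ι → X → X} {m : ι → 𝒢}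
    (h : ∀ k g, T k (Φ g) = Φ (m k * g)) (L : List ι) (g : 𝒢) :
    L.foldr (fun k f => T k f) (Φ g) = Φ ((L.map m).prod * g) := by
  induction L with
  | nil => simp
  | cons k L ih => rw [List.foldr_cons, ih, h, List.map_cons, List.prod_cons, mul_assoc]

theorem diffOp_multiplier {d : ℕ} {𝒢 : Type*} [CommRing 𝒢] [Algebra ℂ 𝒢]
    (Φ : 𝒢 →ₗ[ℂ] (EuclideanSpace ℝ (Fin d) → ℂ)) {m : Fin d → 𝒢}
    (h : ∀ j g, partialD j (Φ g) = Φ (m j * g)) (p : MvPolynomial (Fin d) ℂ) (g : 𝒢) :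
    diffOp p (Φ g) = Φ (MvPolynomial.aeval m p * g) := by
  have h1 : ∀ α : Fin d →₀ ℕ, multiD α (Φ g) = Φ ((∏ j, m j ^ α j) * g) := by
    intro α
    rw [Fin.prod_univ_def]
    exact foldr_multiplier (fun j g => iterate_multiplier (h j) (α j) g) _ g
  funext y
  simp only [diffOp, h1]
  rw [MvPolynomial.aeval_def, MvPolynomial.eval₂_eq', Finset.sum_mul, map_sum, Finset.sum_apply]
  refine Finset.sum_congr rfl fun α _ => ?_
  rw [mul_assoc, ← Algebra.smul_def, map_smul, Pi.smul_apply, smul_eq_mul]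

/-- Commutativity of `𝒢` makes the order of the nested differences irrelevant, so the coefficient
polynomial is simply evaluated at the multipliers of the single differences. -/
theorem differenceOp_multiplier {d : ℕ} {G 𝒢 : Type*} [AddCommGroup G] [CommRing 𝒢] [Algebra ℂ 𝒢]
    (Φ : 𝒢 →ₗ[ℂ] (G → ℂ)) {e : Fin d → G} {m : Fin d × Bool → 𝒢}
    (hf : ∀ k g, fwdDiff (e k) (Φ g) = Φ (m (k, true) * g))
    (hb : ∀ k g, fwdDiff (-e k) (Φ g) = Φ (m (k, false) * g))
    (l : ℕ) (a : MvPolynomial (Fin d × Bool) ℂ) (ε : ℝ) (g : 𝒢) (y : G) :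
    differenceOp l a ε e (Φ g) y =
      (((ε ^ l)⁻¹ : ℝ) : ℂ) * Φ (MvPolynomial.aeval m a * g) y := by
  have h1 : ∀ ν : Fin d × Bool →₀ ℕ, (List.finRange d).foldr
      (fun k f => (fwdDiff (-e k))^[ν (k, false)] ((fwdDiff (e k))^[ν (k, true)] f)) (Φ g) =
        Φ ((∏ p, m p ^ ν p) * g) := by
    intro ν
    rw [Fintype.prod_prod_type, Fin.prod_univ_def]
    refine foldr_multiplier (T := fun k f =>
      (fwdDiff (-e k))^[ν (k, false)] ((fwdDiff (e k))^[ν (k, true)] f)) (fun k g => ?_) _ g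
    rw [iterate_multiplier (hf k), iterate_multiplier (hb k), Fintype.prod_bool]
    congr 1
    ring
  unfold differenceOp
  simp only [h1]
  rw [MvPolynomial.aeval_def, MvPolynomial.eval₂_eq', Finset.sum_mul, map_sum, Finset.sum_apply]
  congr 1
  refine Finset.sum_congr rfl fun ν _ => ?_
  rw [mul_assoc, ← Algebra.smul_def, map_smul, Pi.smul_apply, smul_eq_mul]

/-! ### Plane waves -/

/-- The plane wave `e^{i x·θ}`. -/
def planeWave {d : ℕ} (x θ : Fin d → ℝ) : ℂ :=
  Complex.exp (Complex.I * ((∑ j, x j * θ j : ℝ) : ℂ))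

theorem norm_planeWave {d : ℕ} (x θ : Fin d → ℝ) : ‖planeWave x θ‖ = 1 := by
  rw [planeWave, mul_comm, Complex.norm_exp_ofReal_mul_I]

theorem planeWave_add_left {d : ℕ} (x y θ : Fin d → ℝ) :
    planeWave (x + y) θ = planeWave x θ * planeWave y θ := by
  rw [planeWave, planeWave, planeWave, ← Complex.exp_add]
  simp only [Pi.add_apply, add_mul, Finset.sum_add_distrib]
  push_cast
  ring_nf

theorem planeWave_single {d : ℕ} (k : Fin d) (c : ℝ) (θ : Fin d → ℝ) :
    planeWave (Pi.single k c) θ = Complex.exp (Complex.I * ((c * θ k : ℝ) : ℂ)) := by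
  rw [planeWave, Finset.sum_eq_single k]
  · simp
  · intro j _ hj
    simp [Pi.single_eq_of_ne hj]
  · simp

theorem planeWave_smul {d : ℕ} (c : ℝ) (x θ : Fin d → ℝ) :
    planeWave x (c • θ) = planeWave (c • x) θ := by
  simp only [planeWave, Pi.smul_apply, smul_eq_mul]
  congr 4
  funext j
  ring

@[fun_prop]
theorem continuous_planeWave {d : ℕ} (x : Fin d → ℝ) : Continuous (planeWave x) := by
  unfold planeWave
  fun_prop

theorem iteratedDeriv_exp_I_mul (n : ℕ) :
    iteratedDeriv n (fun t : ℝ => Complex.exp (Complex.I * t)) =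
      fun t : ℝ => Complex.I ^ n * Complex.exp (Complex.I * t) := by
  induction n with
  | zero => simp
  | succ n ih =>
    rw [iteratedDeriv_succ, ih]
    funext t
    have h : HasDerivAt (fun t : ℝ => Complex.I * (t : ℂ)) Complex.I t := by
      simpa using (Complex.ofRealCLM.hasDerivAt (x := t)).const_mul Complex.I
    have h2 := (h.cexp.const_mul (Complex.I ^ n)).deriv
    rw [h2]
    ring

/-- A plane wave is `e^{it}` composed with a linear functional `L`, so its `n`-th derivative is at
most `‖L‖^n`. This makes it an admissible test function in the approximation hypothesis. -/
theorem isSmoothBounded_planeWave {d : ℕ} (ξ : Fin d → ℝ) :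
    IsSmoothBounded (fun y : EuclideanSpace ℝ (Fin d) => planeWave y.ofLp ξ) := by
  let L : EuclideanSpace ℝ (Fin d) →L[ℝ] ℝ := innerSL ℝ (WithLp.toLp 2 ξ)
  let g : ℝ → ℂ := fun t => Complex.exp (Complex.I * t)
  have hg : ContDiff ℝ ∞ g := by
    have : ContDiff ℝ ∞ (fun t : ℝ => (t : ℂ)) := Complex.ofRealCLM.contDiff
    exact (contDiff_const.mul this).cexp
  have he : (fun y : EuclideanSpace ℝ (Fin d) => planeWave y.ofLp ξ) = g ∘ L := by
    funext y
    simp [g, L, planeWave, PiLp.inner_apply]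
  rw [he]
  refine ⟨hg.comp L.contDiff, fun n => ⟨1 * ∏ _i : Fin n, ‖L‖, fun y => ?_⟩⟩
  rw [L.iteratedFDeriv_comp_right hg y (by exact_mod_cast le_top)]
  refine (ContinuousMultilinearMap.norm_compContinuousLinearMap_le _ _).trans ?_
  gcongr
  rw [norm_iteratedFDeriv_eq_norm_iteratedDeriv, iteratedDeriv_exp_I_mul]
  simp [Complex.norm_exp]

theorem diffOp_planeWave {d : ℕ} (p : MvPolynomial (Fin d) ℂ) (ξ : Fin d → ℝ) :
    diffOp p (fun y => planeWave y.ofLp ξ) = fun y =>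
      MvPolynomial.eval (fun j => (ξ j : ℂ)) p * planeWave y.ofLp ξ := by
  let u : EuclideanSpace ℝ (Fin d) → ℂ := fun y => planeWave y.ofLp ξ
  have h := diffOp_multiplier (LinearMap.toSpanSingleton ℂ _ u) (m := fun j => (ξ j : ℂ)) ?_ p 1
  · simp only [LinearMap.toSpanSingleton_apply, one_smul, mul_one] at h
    rw [h]
    funext y
    simp [u, MvPolynomial.aeval_eq_eval]
  · intro j c
    funext y
    simp only [LinearMap.toSpanSingleton_apply, Pi.smul_apply, smul_eq_mul, partialD]
    have hd : HasDerivAt (fun t : ℝ => c * planeWave (y + t • EuclideanSpace.single j (1 : ℝ)).ofLp ξ)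
        (c * (planeWave y.ofLp ξ * (Complex.I * ξ j))) 0 := by
      have h1 : ∀ t : ℝ, planeWave (y + t • EuclideanSpace.single j (1 : ℝ)).ofLp ξ =
          planeWave y.ofLp ξ * Complex.exp (Complex.I * ξ j * t) := by
        intro t
        have h2 : (y + t • EuclideanSpace.single j (1 : ℝ)).ofLp = y.ofLp + Pi.single j t := by
          ext i
          by_cases hi : i = j
          · subst hi; simp
          · simp [hi]
        rw [h2, planeWave_add_left, planeWave_single]
        push_cast
        ring_nf
      simp only [h1]
      have h3 : HasDerivAt (fun t : ℝ => Complex.I * ξ j * (t : ℂ)) (Complex.I * ξ j) 0 := by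
        simpa using (Complex.ofRealCLM.hasDerivAt (x := 0)).const_mul (Complex.I * (ξ j : ℂ))
      simpa using (h3.cexp.const_mul (planeWave y.ofLp ξ)).const_mul c
    have h2 : lineDeriv ℝ (c • u) y (EuclideanSpace.single j 1) = _ := hd.deriv
    rw [h2]
    linear_combination -(c * planeWave y.ofLp ξ * (ξ j : ℂ)) * Complex.I_mul_I

theorem differenceOp_planeWave {d : ℕ} (l : ℕ) (a : MvPolynomial (Fin d × Bool) ℂ) (ε : ℝ)
    (ξ : Fin d → ℝ) :
    differenceOpSpace l a ε (fun y => planeWave y.ofLp ξ) = fun y =>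
      (((ε ^ l)⁻¹ : ℝ) : ℂ) * (discreteSymbol a (ε • ξ) * planeWave y.ofLp ξ) := by
  let u : EuclideanSpace ℝ (Fin d) → ℂ := fun y => planeWave y.ofLp ξ
  funext y
  have h := differenceOp_multiplier (LinearMap.toSpanSingleton ℂ _ u)
    (e := fun k => EuclideanSpace.single k ε)
    (m := fun p => Complex.exp (signI p.2 * (((ε • ξ) p.1 : ℝ) : ℂ)) - 1) ?_ ?_ l a ε 1 y
  · simp only [LinearMap.toSpanSingleton_apply, one_smul, mul_one] at h
    refine h.trans ?_
    simp [u, MvPolynomial.aeval_eq_eval, discreteSymbol]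
  · intro k c
    funext y
    have h2 : (y + EuclideanSpace.single k ε).ofLp = y.ofLp + Pi.single k ε := by
      ext i; simp [Pi.single_apply]
    simp only [fwdDiff, LinearMap.toSpanSingleton_apply, Pi.smul_apply, smul_eq_mul, u, h2,
      planeWave_add_left, planeWave_single, signI]
    simp only [if_true]
    ring
  · intro k c
    funext y
    have h2 : (y + -EuclideanSpace.single k ε).ofLp = y.ofLp + Pi.single k (-ε) := by
      ext i
      by_cases hi : i = k
      · subst hi; simp
      · simp [hi]
    simp only [fwdDiff, LinearMap.toSpanSingleton_apply, Pi.smul_apply, smul_eq_mul, u, h2,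
      planeWave_add_left, planeWave_single, signI]
    simp
    ring

/-! ### The order of approximation in terms of the symbols -/

/-- Letting `z → 0+` kills the constant coefficient; then divide by `z` and induct. -/
theorem coeff_eq_zero_of_norm_sum_le (n : ℕ) (c : ℕ → ℂ) (C : ℝ)
    (h : ∀ z : ℝ, 0 < z → z ≤ 1 → ‖∑ k ∈ Finset.range n, (z : ℂ) ^ k * c k‖ ≤ C * z ^ n) :
    ∀ k < n, c k = 0 := by
  induction n generalizing c with
  | zero => simp
  | succ n ih =>
    have h0 : c 0 = 0 := by
      have hmem : ∀ᶠ z : ℝ in nhdsWithin 0 (Set.Ioi 0),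
          ‖∑ k ∈ Finset.range (n + 1), (z : ℂ) ^ k * c k‖ ≤ C * z ^ (n + 1) := by
        filter_upwards [Ioc_mem_nhdsGT zero_lt_one] with z hz using h z hz.1 hz.2
      have h1 : Filter.Tendsto (fun z : ℝ => ‖∑ k ∈ Finset.range (n + 1), (z : ℂ) ^ k * c k‖)
          (nhdsWithin 0 (Set.Ioi 0)) (nhds ‖c 0‖) := by
        have hc : Continuous fun z : ℝ => ‖∑ k ∈ Finset.range (n + 1), (z : ℂ) ^ k * c k‖ := by
          fun_prop
        have := hc.tendsto 0
        simp only [Finset.sum_range_succ', Complex.ofReal_zero] at this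
        simpa [Finset.sum_range_succ'] using this.mono_left nhdsWithin_le_nhds
      have h2 : Filter.Tendsto (fun z : ℝ => C * z ^ (n + 1))
          (nhdsWithin 0 (Set.Ioi 0)) (nhds 0) := by
        have hc : Continuous fun z : ℝ => C * z ^ (n + 1) := by fun_prop
        simpa using (hc.tendsto 0).mono_left nhdsWithin_le_nhds
      exact norm_le_zero_iff.1 (le_of_tendsto_of_tendsto h1 h2 hmem)
    have h1 := ih (fun k => c (k + 1)) fun z hz hz1 => by
      have h2 := h z hz hz1
      rw [Finset.sum_range_succ', h0, mul_zero, add_zero] at h2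
      have h3 : ∑ k ∈ Finset.range n, (z : ℂ) ^ (k + 1) * c (k + 1) =
          z * ∑ k ∈ Finset.range n, (z : ℂ) ^ k * c (k + 1) := by
        rw [Finset.mul_sum]
        exact Finset.sum_congr rfl fun k _ => by ring
      rw [h3, norm_mul, Complex.norm_real, Real.norm_of_nonneg hz.le] at h2
      refine le_of_mul_le_mul_left (h2.trans_eq ?_) hz
      ring
    intro k hk
    rcases k with _ | k
    · exact h0
    · exact h1 k (by omega)

/-- On the wave `e^{i y·ξ}` at `y = 0` the approximation hypothesis reads `z^{-l} A(zξ) - P(ξ) =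
O(z^M)` for fixed `ξ`. Comparison with the expansion of `A(zξ)` leaves a polynomial in `z` of degree
below `l + M` and of size `O(z^{l+M})`, which must be zero. -/
theorem coeff_symbolSeries {d l M : ℕ} (hM : 0 < M) {P : MvPolynomial (Fin d) ℂ}
    {a : MvPolynomial (Fin d × Bool) ℂ} (h : IsApproximation l a P M) {n : ℕ} (hn : n < l + M) :
    PowerSeries.coeff n (symbolSeries a) = if n = l then P else 0 := by
  -- Real points suffice: a polynomial is determined by its values on a product of infinite sets.
  refine MvPolynomial.funext_set (fun _ => Set.range ((↑) : ℝ → ℂ))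
    (fun _ => Set.infinite_range_of_injective Complex.ofReal_injective) fun x hx => ?_
  choose ξ hξ using fun j => hx j (Set.mem_univ j)
  obtain rfl : (fun j => (ξ j : ℂ)) = x := funext hξ
  obtain ⟨C, -, hC⟩ := h _ (isSmoothBounded_planeWave ξ)
  obtain ⟨C', N, -, hC'⟩ := hasExpansion_discreteSymbol 1 a (l + M)
  have key := coeff_eq_zero_of_norm_sum_le (l + M)
    (fun n => MvPolynomial.eval (fun j => (ξ j : ℂ)) (PowerSeries.coeff n (symbolSeries a)) -
      if n = l then MvPolynomial.eval (fun j => (ξ j : ℂ)) P else 0)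
    (C + C' * (1 + ‖ξ‖) ^ N) ?_ n hn
  · rw [sub_eq_zero] at key
    rw [key]
    split <;> simp
  · intro z hz hz1
    have h1 : ‖discreteSymbol a (z • ξ) - truncEval (symbolSeries a) (l + M) z ξ‖ ≤ _ :=
      hC' z hz hz1 ξ
    have h2 := hC z hz 0
    rw [differenceOp_planeWave, diffOp_planeWave] at h2
    have h3 : planeWave (WithLp.ofLp (0 : EuclideanSpace ℝ (Fin d))) ξ = 1 := by simp [planeWave]
    beta_reduce at h2
    rw [h3, mul_one, mul_one] at h2
    have hz0 : (z : ℂ) ≠ 0 := by exact_mod_cast hz.ne'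
    have h4 : ∑ k ∈ Finset.range (l + M), (z : ℂ) ^ k *
        (MvPolynomial.eval (fun j => (ξ j : ℂ)) (PowerSeries.coeff k (symbolSeries a)) -
          if k = l then MvPolynomial.eval (fun j => (ξ j : ℂ)) P else 0) =
        (z : ℂ) ^ l * ((((z ^ l)⁻¹ : ℝ) : ℂ) * discreteSymbol a (z • ξ) -
          MvPolynomial.eval (fun j => (ξ j : ℂ)) P) -
        (discreteSymbol a (z • ξ) - truncEval (symbolSeries a) (l + M) z ξ) := by
      simp only [mul_sub, Finset.sum_sub_distrib, mul_ite, mul_zero, Finset.sum_ite_eq',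
        Finset.mem_range, Nat.lt_add_right_iff_pos, hM, if_true, truncEval]
      push_cast
      field_simp
      ring
    rw [h4]
    refine (norm_sub_le_of_le (r₁ := z ^ l * (C * z ^ M)) ?_ h1).trans_eq ?_
    · rw [norm_mul, norm_pow, Complex.norm_real, Real.norm_of_nonneg hz.le]
      gcongr
    · rw [pow_add]; ring

theorem coeff_scaledSeries {d l M : ℕ} (hM : 0 < M) {P : MvPolynomial (Fin d) ℂ}
    {a : MvPolynomial (Fin d × Bool) ℂ} (h : IsApproximation l a P M) {k : ℕ} (hk : k < M) :
    PowerSeries.coeff k (scaledSeries l a) = if k = 0 then P else 0 := by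
  rw [scaledSeries, PowerSeries.coeff_mk, coeff_symbolSeries hM h (by omega)]
  simp

theorem hasExpansion_scaledSymbol {d l M : ℕ} (hM : 0 < M) {P : MvPolynomial (Fin d) ℂ}
    {a : MvPolynomial (Fin d × Bool) ℂ} (h : IsApproximation l a P M) (z₁ : ℝ) :
    HasExpansion z₁ (fun z ξ => ((z : ℂ) ^ l)⁻¹ * discreteSymbol a (z • ξ)) (scaledSeries l a) :=
  (hasExpansion_discreteSymbol z₁ a).div_pow l fun n hn => by
    rw [coeff_symbolSeries hM h (by omega), if_neg hn.ne]

end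

/-! ### The profile `H`, its derivatives and the algebra of the expansion polynomials. -/

noncomputable section

open MeasureTheory

/-! ### Integrability against `e^{-c |ξ|^l}` -/

theorem exists_pow_mul_exp_neg_le {c : ℝ} (hc : 0 < c) {l : ℕ} (hl : 0 < l) (m : ℕ) :
    ∃ C : ℝ, 0 ≤ C ∧ ∀ x : ℝ, 0 ≤ x → (1 + x) ^ m * Real.exp (-(c * x ^ l)) ≤ C := by
  -- Since `x^l ≥ x - 1`, and `y^m ≤ m! e^y` with `y = c(1 + x)`, the exponents `c(1 + x)` and `-c(x
  -- - 1)` add up to `2c`.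
  refine ⟨m.factorial / c ^ m * Real.exp (2 * c), by positivity, fun x hx => ?_⟩
  have h1 : x - 1 ≤ x ^ l := by
    rcases le_total x 1 with h | h
    · exact (sub_nonpos.2 h).trans (by positivity)
    · exact (sub_le_self _ zero_le_one).trans (le_self_pow₀ h hl.ne')
  have h2 : (1 + x) ^ m ≤ m.factorial / c ^ m * Real.exp (c * (1 + x)) := by
    have := Real.pow_div_factorial_le_exp (c * (1 + x)) (by positivity) m
    rw [div_le_iff₀ (by positivity), mul_pow] at this
    rw [div_mul_eq_mul_div, le_div_iff₀ (by positivity)]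
    linarith
  calc (1 + x) ^ m * Real.exp (-(c * x ^ l))
      ≤ (m.factorial / c ^ m * Real.exp (c * (1 + x))) * Real.exp (-(c * (x - 1))) := by
        gcongr
    _ = _ := by
        rw [mul_assoc, ← Real.exp_add]
        ring_nf

/-- The exponential absorbs `n + 1` additional powers of `1 + |x|`, where `n` is the dimension, and
`(1 + |x|)^{-(n+1)}` is integrable. -/
theorem integrable_of_norm_le_pow_mul_exp {V : Type*} [NormedAddCommGroup V] [NormedSpace ℝ V]
    [FiniteDimensional ℝ V] [MeasurableSpace V] [BorelSpace V] {μ : Measure V}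
    [μ.IsAddHaarMeasure] {F : Type*} [NormedAddCommGroup F] {f : V → F}
    (hf : AEStronglyMeasurable f μ) {c : ℝ} (hc : 0 < c) {l : ℕ} (hl : 0 < l) {C : ℝ} (hC : 0 ≤ C)
    {N : ℕ} (h : ∀ x, ‖f x‖ ≤ C * (1 + ‖x‖) ^ N * Real.exp (-(c * ‖x‖ ^ l))) :
    Integrable f μ := by
  set n := Module.finrank ℝ V
  obtain ⟨B, hB, hB'⟩ := exists_pow_mul_exp_neg_le hc hl (N + (n + 1))
  have hi : Integrable (fun x : V => (1 + ‖x‖) ^ (-((n + 1 : ℕ) : ℝ))) μ :=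
    integrable_one_add_norm (by push_cast; linarith)
  refine (hi.const_mul (C * B)).mono' hf (Filter.Eventually.of_forall fun x => (h x).trans ?_)
  have h1 : 0 < 1 + ‖x‖ := by positivity
  rw [Real.rpow_neg h1.le, Real.rpow_natCast, ← div_eq_mul_inv, le_div_iff₀ (by positivity)]
  calc C * (1 + ‖x‖) ^ N * Real.exp (-(c * ‖x‖ ^ l)) * (1 + ‖x‖) ^ (n + 1)
      = C * ((1 + ‖x‖) ^ (N + (n + 1)) * Real.exp (-(c * ‖x‖ ^ l))) := by rw [pow_add]; ring
    _ ≤ C * B := by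
        gcongr
        exact hB' _ (norm_nonneg _)

/-! ### The profile and its derivatives as Fourier integrals -/

theorem norm_le_norm_toLp {d : ℕ} (ξ : Fin d → ℝ) : ‖ξ‖ ≤ ‖WithLp.toLp 2 ξ‖ := by
  rw [pi_norm_le_iff_of_nonneg (norm_nonneg _)]
  exact fun i => PiLp.norm_apply_le (WithLp.toLp 2 ξ) i

/-- The value of a polynomial at a real point of the coordinate space. -/
def evalReal {d : ℕ} (p : MvPolynomial (Fin d) ℂ) (ξ : Fin d → ℝ) : ℂ :=
  MvPolynomial.eval (fun j => (ξ j : ℂ)) p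

@[fun_prop]
theorem continuous_evalReal {d : ℕ} (p : MvPolynomial (Fin d) ℂ) : Continuous (evalReal p) := by
  unfold evalReal
  simp only [MvPolynomial.eval_eq]
  fun_prop

theorem exists_norm_evalReal_le {d : ℕ} (p : MvPolynomial (Fin d) ℂ) :
    ∃ (C : ℝ) (N : ℕ), 0 ≤ C ∧ ∀ ξ, ‖evalReal p ξ‖ ≤ C * (1 + ‖ξ‖) ^ N := by
  obtain ⟨C, N, hC, h⟩ := IsPolyO.eval (z₁ := 1) p
  exact ⟨C, N, hC, fun ξ => by simpa [evalReal] using h 1 one_pos le_rfl ξ⟩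

/-- The norm on `Fin d → ℝ` is the supremum norm; it is dominated by the Euclidean one, so the same
constant works. -/
theorem IsStronglyElliptic.exists_le_evalReal {d l : ℕ} {P : MvPolynomial (Fin d) ℂ}
    (h : IsStronglyElliptic l P) : ∃ c : ℝ, 0 < c ∧ ∀ ξ, c * ‖ξ‖ ^ l ≤ (evalReal P ξ).re := by
  obtain ⟨c, hc, h⟩ := h
  refine ⟨c, hc, fun ξ => le_trans ?_ (h (WithLp.toLp 2 ξ))⟩
  have := norm_le_norm_toLp ξ
  gcongr

theorem norm_exp_neg_le {d l : ℕ} {P : MvPolynomial (Fin d) ℂ} {c : ℝ} {ξ : Fin d → ℝ}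
    (h : c * ‖ξ‖ ^ l ≤ (evalReal P ξ).re) :
    ‖Complex.exp (-evalReal P ξ)‖ ≤ Real.exp (-(c * ‖ξ‖ ^ l)) := by
  rw [Complex.norm_exp, Complex.neg_re]
  exact Real.exp_le_exp.2 (neg_le_neg h)

theorem integrable_evalReal_mul_exp {d l : ℕ} (hl : 0 < l) {P : MvPolynomial (Fin d) ℂ}
    (hP : IsStronglyElliptic l P) (Q : MvPolynomial (Fin d) ℂ) :
    Integrable (fun ξ => evalReal Q ξ * Complex.exp (-evalReal P ξ)) := by
  obtain ⟨c, hc, h⟩ := hP.exists_le_evalReal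
  obtain ⟨C, N, hC, hQ⟩ := exists_norm_evalReal_le Q
  refine integrable_of_norm_le_pow_mul_exp (by fun_prop) hc hl hC (N := N) fun ξ => ?_
  rw [norm_mul]
  exact mul_le_mul (hQ ξ) (norm_exp_neg_le (h ξ)) (norm_nonneg _) (by positivity)

theorem MeasureTheory.Integrable.mul_planeWave {d : ℕ} {f : (Fin d → ℝ) → ℂ}
    {μ : Measure (Fin d → ℝ)} (hf : Integrable f μ) (x : Fin d → ℝ) :
    Integrable (fun ξ => f ξ * planeWave x ξ) μ :=
  hf.mul_bdd (c := 1) (by fun_prop) (Filter.Eventually.of_forall fun ξ => (norm_planeWave x ξ).le)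

/-- The function `(2π)^{-d} ∫ Q(ξ) e^{-P(ξ)} e^{i y·ξ} dξ`. -/
def profileIntegral {d : ℕ} (P Q : MvPolynomial (Fin d) ℂ) (y : EuclideanSpace ℝ (Fin d)) : ℂ :=
  ((2 * Real.pi : ℝ) : ℂ)⁻¹ ^ d *
    ∫ ξ : Fin d → ℝ, evalReal Q ξ * Complex.exp (-evalReal P ξ) * planeWave y.ofLp ξ

theorem greenProfile_eq_profileIntegral {d : ℕ} (P : MvPolynomial (Fin d) ℂ) :
    greenProfile P = profileIntegral P 1 := by
  funext y
  unfold greenProfile profileIntegral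
  congr 1
  rw [← (PiLp.volume_preserving_toLp (Fin d)).integral_comp
    (MeasurableEquiv.toLp 2 (Fin d → ℝ)).measurableEmbedding]
  refine integral_congr_ae (Filter.Eventually.of_forall fun ξ => ?_)
  simp only [symbolAt, evalReal, planeWave, map_one, one_mul, PiLp.inner_apply]
  simp [mul_comm]

/-- All moments of `e^{-P}` are integrable, so its Fourier transform is smooth. The dilation by
`-1/(2π)` converts the kernel `e^{-2πi y·ξ}` into `e^{i y·ξ}`. -/
theorem contDiff_greenProfile {d l : ℕ} (hl : 0 < l) {P : MvPolynomial (Fin d) ℂ}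
    (hP : IsStronglyElliptic l P) : ContDiff ℝ ∞ (greenProfile P) := by
  let f : EuclideanSpace ℝ (Fin d) → ℂ := fun ξ => Complex.exp (-symbolAt P ξ)
  obtain ⟨c, hc, h⟩ := hP
  have hcont : Continuous f := by
    have : Continuous (symbolAt P) := by
      unfold symbolAt
      simp only [MvPolynomial.eval_eq]
      fun_prop
    fun_prop
  have hF : ContDiff ℝ ∞ (FourierTransform.fourier f) := by
    refine Real.contDiff_fourier (N := ⊤) fun n _ => ?_
    refine integrable_of_norm_le_pow_mul_exp (by fun_prop) hc hl zero_le_one (N := n) fun ξ => ?_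
    rw [norm_mul, norm_norm, norm_pow, norm_norm, one_mul, Complex.norm_exp, Complex.neg_re]
    have := h ξ
    gcongr
    linarith
  have he : greenProfile P = fun y =>
      ((2 * Real.pi : ℝ) : ℂ)⁻¹ ^ d * FourierTransform.fourier f ((-(2 * Real.pi)⁻¹ : ℝ) • y) := by
    funext y
    rw [greenProfile, Real.fourier_eq']
    congr 1
    refine integral_congr_ae (Filter.Eventually.of_forall fun ξ => ?_)
    simp only [f, smul_eq_mul, inner_smul_right, real_inner_comm]
    rw [mul_comm]
    congr 2
    push_cast
    have : (Real.pi : ℂ) ≠ 0 := by exact_mod_cast Real.pi_ne_zero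
    field_simp
  rw [he]
  exact contDiff_const.mul (hF.comp (contDiff_const_smul _))

/-- `Q ↦ (2π)^{-d} ∫ Q(ξ) e^{-P(ξ)} e^{i y·ξ} dξ` as a linear map. -/
def profileMap {d l : ℕ} (hl : 0 < l) {P : MvPolynomial (Fin d) ℂ} (hP : IsStronglyElliptic l P) :
    MvPolynomial (Fin d) ℂ →ₗ[ℂ] (EuclideanSpace ℝ (Fin d) → ℂ) where
  toFun Q := profileIntegral P Q
  map_add' Q Q' := by
    funext y
    simp only [profileIntegral, Pi.add_apply, ← mul_add]
    rw [← integral_add ((integrable_evalReal_mul_exp hl hP Q).mul_planeWave _)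
      ((integrable_evalReal_mul_exp hl hP Q').mul_planeWave _)]
    congr 2
    funext ξ
    simp only [evalReal, map_add]
    ring
  map_smul' c Q := by
    funext y
    simp only [profileIntegral, Pi.smul_apply, smul_eq_mul, RingHom.id_apply]
    rw [mul_left_comm c, ← integral_const_mul c]
    congr 2
    funext ξ
    simp only [evalReal, MvPolynomial.smul_eval]
    ring

/-- Differentiation under the integral: plane waves have modulus one, so `|ξ_j Q e^{-P}|` dominates
independently of the shift, and the factor `-i` in `D_j` cancels the `i` brought down. -/
theorem partialD_profileIntegral {d l : ℕ} (hl : 0 < l) {P : MvPolynomial (Fin d) ℂ}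
    (hP : IsStronglyElliptic l P) (j : Fin d) (Q : MvPolynomial (Fin d) ℂ) :
    partialD j (profileIntegral P Q) = profileIntegral P (MvPolynomial.X j * Q) := by
  funext y
  let e : EuclideanSpace ℝ (Fin d) := EuclideanSpace.single j 1
  let G : (Fin d → ℝ) → ℂ := fun ξ => evalReal Q ξ * Complex.exp (-evalReal P ξ)
  have hG : Integrable G := integrable_evalReal_mul_exp hl hP Q
  have hjG : Integrable (fun ξ : Fin d → ℝ => (ξ j : ℂ) * G ξ) := by
    refine (integrable_evalReal_mul_exp hl hP (MvPolynomial.X j * Q)).congr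
      (Filter.Eventually.of_forall fun ξ => ?_)
    simp [evalReal, G, mul_assoc]
  have hwave : ∀ (t : ℝ) (ξ : Fin d → ℝ), planeWave (y + t • e).ofLp ξ =
      planeWave y.ofLp ξ * Complex.exp (Complex.I * ξ j * t) := by
    intro t ξ
    have h2 : (y + t • e).ofLp = y.ofLp + Pi.single j t := by
      ext i
      by_cases hi : i = j
      · subst hi; simp [e]
      · simp [e, hi]
    rw [h2, planeWave_add_left, planeWave_single]
    push_cast
    ring_nf
  have hder := (hasDerivAt_integral_of_dominated_loc_of_deriv_le (μ := volume)
    (F := fun (t : ℝ) ξ => G ξ * planeWave (y + t • e).ofLp ξ) (x₀ := 0)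
    (F' := fun (t : ℝ) ξ => Complex.I * ((ξ j : ℂ) * G ξ * planeWave (y + t • e).ofLp ξ))
    (bound := fun ξ => ‖(ξ j : ℂ) * G ξ‖) (s := Set.univ) Filter.univ_mem
    (Filter.Eventually.of_forall fun t => (hG.mul_planeWave _).aestronglyMeasurable)
    (hG.mul_planeWave _) ((hjG.mul_planeWave _).const_mul Complex.I).aestronglyMeasurable
    (Filter.Eventually.of_forall fun ξ t _ => by
      rw [norm_mul, norm_mul _ (planeWave _ _), norm_planeWave]; simp)
    hjG.norm
    (Filter.Eventually.of_forall fun ξ t _ => by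
      simp only [hwave]
      have h3 : HasDerivAt (fun t : ℝ => Complex.I * ξ j * (t : ℂ)) (Complex.I * ξ j) t := by
        simpa using (Complex.ofRealCLM.hasDerivAt (x := t)).const_mul (Complex.I * (ξ j : ℂ))
      refine ((h3.cexp.const_mul (planeWave y.ofLp ξ)).const_mul (G ξ)).congr_deriv ?_
      ring)).2
  have h2 : lineDeriv ℝ (profileIntegral P Q) y e = _ :=
    (hder.const_mul (((2 * Real.pi : ℝ) : ℂ)⁻¹ ^ d)).deriv
  have hI : ∀ x : ℂ, -Complex.I * (Complex.I * x) = x := fun x => by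
    linear_combination -x * Complex.I_mul_I
  simp only [partialD, profileIntegral]
  erw [h2]
  rw [integral_const_mul, mul_left_comm (_ ^ d) Complex.I, hI]
  congr 2
  funext ξ
  simp [evalReal, G, mul_assoc]

theorem diffOp_profileIntegral {d l : ℕ} (hl : 0 < l) {P : MvPolynomial (Fin d) ℂ}
    (hP : IsStronglyElliptic l P) (p Q : MvPolynomial (Fin d) ℂ) :
    diffOp p (profileIntegral P Q) = profileIntegral P (p * Q) := by
  have h := diffOp_multiplier (profileMap hl hP) (m := MvPolynomial.X)
    (fun j Q => partialD_profileIntegral hl hP j Q) p Q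
  rwa [MvPolynomial.aeval_X_left_apply] at h

theorem expansionTerm_eq_profileIntegral {d l : ℕ} (hl : 0 < l) {P : MvPolynomial (Fin d) ℂ}
    (hP : IsStronglyElliptic l P) (a : MvPolynomial (Fin d × Bool) ℂ) (J k : ℕ) :
    expansionTerm l a P J k = profileIntegral P (expansionPoly l a J k) := by
  rw [expansionTerm, greenProfile_eq_profileIntegral, diffOp_profileIntegral hl hP, mul_one]

theorem iterate_neg_diffOp_greenProfile {d l : ℕ} (hl : 0 < l) {P : MvPolynomial (Fin d) ℂ}
    (hP : IsStronglyElliptic l P) (J : ℕ) :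
    (fun f => -diffOp P f)^[J] (greenProfile P) = profileIntegral P ((-P) ^ J) := by
  rw [greenProfile_eq_profileIntegral]
  have h := iterate_multiplier (Φ := profileMap hl hP) (T := fun f => -diffOp P f) (m := -P)
    (fun Q => by
      have h1 := diffOp_profileIntegral hl hP P Q
      change -diffOp P (profileIntegral P Q) = _
      rw [h1, neg_mul, map_neg]
      rfl) J 1
  rw [mul_one] at h
  exact h

/-! ### The polynomials of the expansion -/

/-- The exponential series may be cut off at any sufficiently high degree. -/
theorem expansionPoly_eq {d : ℕ} (l : ℕ) (a : MvPolynomial (Fin d × Bool) ℂ) (J : ℕ) {k n : ℕ}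
    (hk : k < n) :
    expansionPoly l a J k = PowerSeries.coeff k ((-scaledSeries l a) ^ J *
      ∑ m ∈ Finset.range n, ((m.factorial : ℂ)⁻¹) •
        (PowerSeries.C (PowerSeries.coeff 0 (scaledSeries l a)) - scaledSeries l a) ^ m) := by
  rw [expansionPoly, ← Finset.sum_range_add_sum_Ico _ (Nat.succ_le_of_lt hk), mul_add, map_add,
    left_eq_add]
  -- As `S(0) - S` has no constant term, its powers beyond the `k`-th are divisible by `X^{k+1}` and
  -- do not reach the coefficient of degree `k`.
  have hX : (PowerSeries.X : PowerSeries (MvPolynomial (Fin d) ℂ)) ∣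
      PowerSeries.C (PowerSeries.coeff 0 (scaledSeries l a)) - scaledSeries l a := by
    rw [PowerSeries.X_dvd_iff]
    simp
  refine PowerSeries.X_pow_dvd_iff.1 (Dvd.dvd.mul_left (Finset.dvd_sum fun m hm => ?_) _) k
    (Nat.lt_succ_self k)
  rw [Algebra.smul_def]
  exact Dvd.dvd.mul_left ((pow_dvd_pow _ (Finset.mem_Ico.1 hm).1).trans (pow_dvd_pow_of_dvd hX m)) _

theorem expansionPoly_zero {d l M : ℕ} (hM : 0 < M) {P : MvPolynomial (Fin d) ℂ}
    {a : MvPolynomial (Fin d × Bool) ℂ} (h : IsApproximation l a P M) (J : ℕ) :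
    expansionPoly l a J 0 = (-P) ^ J := by
  have h0 := coeff_scaledSeries hM h hM
  rw [if_pos rfl, PowerSeries.coeff_zero_eq_constantCoeff_apply] at h0
  simp [expansionPoly, h0]

/-- Modulo `X^M` the series `S` is the constant `P`. The truncated exponential is then `1` and the
whole product is the constant `(-P)^J`. -/
theorem expansionPoly_eq_zero {d l M : ℕ} (hM : 0 < M) {P : MvPolynomial (Fin d) ℂ}
    {a : MvPolynomial (Fin d × Bool) ℂ} (h : IsApproximation l a P M) (J : ℕ) {k : ℕ}
    (hk : 0 < k) (hkM : k < M) : expansionPoly l a J k = 0 := by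
  set S := scaledSeries l a
  have hd : (PowerSeries.X : PowerSeries (MvPolynomial (Fin d) ℂ)) ^ M ∣ S - PowerSeries.C P := by
    refine PowerSeries.X_pow_dvd_iff.2 fun m hm => ?_
    rw [map_sub, coeff_scaledSeries hM h hm, PowerSeries.coeff_C, sub_self]
  have h0 : PowerSeries.coeff 0 S = P := by simpa using coeff_scaledSeries hM h hM
  have hd' : (PowerSeries.X : PowerSeries (MvPolynomial (Fin d) ℂ)) ^ M ∣
      (-S) ^ J * ∑ m ∈ Finset.range (k + 1), ((m.factorial : ℂ)⁻¹) •
        (PowerSeries.C P - S) ^ m - PowerSeries.C ((-P) ^ J) := by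
    have h1 : (PowerSeries.X : PowerSeries (MvPolynomial (Fin d) ℂ)) ^ M ∣
        (-S) ^ J - PowerSeries.C ((-P) ^ J) := by
      rw [map_pow, map_neg]
      refine dvd_trans ?_ (sub_dvd_pow_sub_pow _ _ J)
      rw [neg_sub_neg, ← dvd_neg, neg_sub]
      exact hd
    have h2 : (PowerSeries.X : PowerSeries (MvPolynomial (Fin d) ℂ)) ^ M ∣
        ∑ m ∈ Finset.range (k + 1), ((m.factorial : ℂ)⁻¹) • (PowerSeries.C P - S) ^ m - 1 := by
      rw [Finset.sum_range_succ']
      simp only [pow_zero, Nat.factorial_zero, Nat.cast_one, inv_one, one_smul, add_sub_cancel_right]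
      refine Finset.dvd_sum fun m _ => ?_
      rw [Algebra.smul_def, pow_succ]
      refine Dvd.dvd.mul_left (Dvd.dvd.mul_left ?_ _) _
      rw [← dvd_neg, neg_sub]
      exact hd
    have h3 := (Dvd.dvd.mul_left h2 ((-S) ^ J)).add h1
    convert h3 using 1
    ring
  have h4 := PowerSeries.X_pow_dvd_iff.1 hd' k hkM
  rw [map_sub, PowerSeries.coeff_C, if_neg hk.ne', sub_zero] at h4
  rw [expansionPoly, h0]
  exact h4

end

/-! ### Fourier series on the cube and the existence of the Green function. -/

noncomputable section

open MeasureTheory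

/-! ### Fourier coefficients on the cube `[-π, π]^d` -/

/-- The cube `[-π, π]^d`. -/
def piCube (d : ℕ) : Set (Fin d → ℝ) := Set.Icc (fun _ => -Real.pi) (fun _ => Real.pi)

theorem isCompact_piCube (d : ℕ) : IsCompact (piCube d) := isCompact_Icc

theorem mem_piCube_iff {d : ℕ} {θ : Fin d → ℝ} : θ ∈ piCube d ↔ ∀ k, |θ k| ≤ Real.pi := by
  simp only [piCube, Set.mem_Icc, Pi.le_def, abs_le]
  exact ⟨fun h k => ⟨h.1 k, h.2 k⟩, fun h => ⟨fun k => (h k).1, fun k => (h k).2⟩⟩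

/-- The point of the grid `ℤ^d` as a real vector. -/
def intPoint {d : ℕ} (s : Fin d → ℤ) : Fin d → ℝ := fun k => (s k : ℝ)

/-- The Fourier coefficient `∫ g(θ) e^{i s·θ} dθ` over the cube. -/
def cubeCoeff {d : ℕ} (g : (Fin d → ℝ) → ℂ) (s : Fin d → ℤ) : ℂ :=
  ∫ θ in piCube d, g θ * planeWave (intPoint s) θ

theorem Continuous.integrableOn_piCube {d : ℕ} {F : Type*} [NormedAddCommGroup F]
    {g : (Fin d → ℝ) → F} (hg : Continuous g) : IntegrableOn g (piCube d) :=
  hg.continuousOn.integrableOn_compact (isCompact_piCube d)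

/-- The Fourier coefficients of a continuous function as a linear map. -/
def cubeCoeffMap (d : ℕ) : C((Fin d → ℝ), ℂ) →ₗ[ℂ] ((Fin d → ℤ) → ℂ) where
  toFun g := cubeCoeff g
  map_add' g h := by
    funext s
    have hg : Continuous fun θ => g θ * planeWave (intPoint s) θ := by fun_prop
    have hh : Continuous fun θ => h θ * planeWave (intPoint s) θ := by fun_prop
    simp only [cubeCoeff, Pi.add_apply, ContinuousMap.add_apply, add_mul]
    exact integral_add hg.integrableOn_piCube hh.integrableOn_piCube
  map_smul' c g := by
    funext s
    simp only [cubeCoeff, Pi.smul_apply, ContinuousMap.smul_apply, smul_eq_mul, mul_assoc,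
      RingHom.id_apply]
    exact integral_const_mul c _

theorem cubeCoeffMap_apply {d : ℕ} (g : C((Fin d → ℝ), ℂ)) (s : Fin d → ℤ) :
    cubeCoeffMap d g s = ∫ θ in piCube d, g θ * planeWave (intPoint s) θ := rfl

theorem norm_cubeCoeff_le {d : ℕ} {g : (Fin d → ℝ) → ℂ} (s : Fin d → ℤ) :
    ‖cubeCoeff g s‖ ≤ ∫ θ in piCube d, ‖g θ‖ := by
  refine (norm_integral_le_integral_norm _).trans_eq ?_
  simp only [norm_mul, norm_planeWave, mul_one]

theorem integral_exp_int_mul (n : ℤ) :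
    ∫ θ in Set.Icc (-Real.pi) Real.pi, Complex.exp (Complex.I * ((n * θ : ℝ) : ℂ)) =
      if n = 0 then ((2 * Real.pi : ℝ) : ℂ) else 0 := by
  rw [integral_Icc_eq_integral_Ioc, ← intervalIntegral.integral_of_le
    (by linarith [Real.pi_pos])]
  split_ifs with h
  · subst h
    simp
    ring
  · have hc : Complex.I * (n : ℂ) ≠ 0 := mul_ne_zero Complex.I_ne_zero (by exact_mod_cast h)
    have h1 := integral_exp_mul_complex (a := -Real.pi) (b := Real.pi) hc
    have h2 : ∀ θ : ℝ, Complex.exp (Complex.I * ((n * θ : ℝ) : ℂ)) =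
        Complex.exp (Complex.I * n * θ) := fun θ => by push_cast; ring_nf
    simp only [h2]
    rw [h1, div_eq_zero_iff]
    left
    rw [sub_eq_zero, Complex.exp_eq_exp_iff_exists_int]
    exact ⟨n, by push_cast; ring⟩

theorem cubeCoeff_one {d : ℕ} (s : Fin d → ℤ) :
    cubeCoeff (fun _ => 1) s = if s = 0 then ((2 * Real.pi : ℝ) : ℂ) ^ d else 0 := by
  have h1 : ∀ θ : Fin d → ℝ, 1 * planeWave (intPoint s) θ =
      ∏ j, Complex.exp (Complex.I * ((s j * θ j : ℝ) : ℂ)) := by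
    intro θ
    rw [one_mul, planeWave, ← Complex.exp_sum]
    congr 1
    push_cast
    rw [Finset.mul_sum]
    rfl
  have h2 : (volume : Measure (Fin d → ℝ)).restrict (piCube d) =
      Measure.pi fun _ => volume.restrict (Set.Icc (-Real.pi) Real.pi) := by
    rw [piCube, ← Set.pi_univ_Icc, volume_pi, Measure.restrict_pi_pi]
  simp only [cubeCoeff, h1, h2]
  rw [integral_fintype_prod_eq_prod (fun j (x : ℝ) => Complex.exp (Complex.I * ((s j * x : ℝ) : ℂ)))]
  simp only [integral_exp_int_mul]
  split_ifs with h
  · simp [h]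
  · obtain ⟨j, hj⟩ := Function.ne_iff.1 h
    exact Finset.prod_eq_zero (Finset.mem_univ j) (if_neg hj)

/-! ### Decay of the Fourier coefficients of smooth periodic functions -/

/-- Smooth functions with period `2π` in every variable. -/
def IsSmoothPeriodic {d : ℕ} (g : (Fin d → ℝ) → ℂ) : Prop :=
  ContDiff ℝ ∞ g ∧ ∀ k θ, g (θ + Pi.single k (2 * Real.pi)) = g θ

theorem IsSmoothPeriodic.mul {d : ℕ} {g h : (Fin d → ℝ) → ℂ} (hg : IsSmoothPeriodic g)
    (hh : IsSmoothPeriodic h) : IsSmoothPeriodic (fun θ => g θ * h θ) :=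
  ⟨hg.1.mul hh.1, fun k θ => by simp only [hg.2, hh.2]⟩

theorem IsSmoothPeriodic.fderiv_apply {d : ℕ} {g : (Fin d → ℝ) → ℂ} (hg : IsSmoothPeriodic g)
    (v : Fin d → ℝ) : IsSmoothPeriodic (fun θ => fderiv ℝ g θ v) := by
  refine ⟨(hg.1.fderiv_right (m := ∞) (by simp)).clm_apply contDiff_const, fun k θ => ?_⟩
  have h : (fun θ => g (θ + Pi.single k (2 * Real.pi))) = g := funext (hg.2 k)
  beta_reduce
  rw [← fderiv_comp_add_right, h]

theorem hasFDerivAt_planeWave {d : ℕ} (x θ : Fin d → ℝ) :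
    HasFDerivAt (planeWave x) (planeWave x θ • Complex.I •
      Complex.ofRealCLM.comp (∑ j, x j • ContinuousLinearMap.proj (R := ℝ) (φ := fun _ => ℝ) j)) θ := by
  have h1 : HasFDerivAt (fun θ : Fin d → ℝ => ∑ j, x j * θ j)
      (∑ j, x j • ContinuousLinearMap.proj (R := ℝ) (φ := fun _ => ℝ) j) θ :=
    HasFDerivAt.fun_sum fun j _ => (ContinuousLinearMap.proj (R := ℝ) (φ := fun _ => ℝ) j).hasFDerivAt.const_mul (x j)
  have h2 := (Complex.ofRealCLM.hasFDerivAt.comp θ h1).const_mul Complex.I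
  exact h2.cexp

theorem fderiv_planeWave_single {d : ℕ} (x θ : Fin d → ℝ) (k : Fin d) :
    fderiv ℝ (planeWave x) θ (Pi.single k 1) = Complex.I * x k * planeWave x θ := by
  rw [(hasFDerivAt_planeWave x θ).fderiv]
  simp [Pi.single_apply]
  ring

theorem contDiff_planeWave {d : ℕ} (x : Fin d → ℝ) : ContDiff ℝ ∞ (planeWave x) := by
  have h1 : ContDiff ℝ ∞ (fun θ : Fin d → ℝ => ∑ j, x j * θ j) := by fun_prop
  exact (contDiff_const.mul (Complex.ofRealCLM.contDiff.comp h1)).cexp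

theorem isSmoothPeriodic_planeWave {d : ℕ} (s : Fin d → ℤ) :
    IsSmoothPeriodic (planeWave (intPoint s)) := by
  refine ⟨contDiff_planeWave _, fun k θ => ?_⟩
  rw [planeWave, planeWave, Complex.exp_eq_exp_iff_exists_int]
  refine ⟨s k, ?_⟩
  simp only [Pi.add_apply, mul_add, Finset.sum_add_distrib]
  rw [Finset.sum_eq_single k (f := fun j => intPoint s j * Pi.single (M := fun _ => ℝ) k (2 * Real.pi) j)
    (fun j _ hj => by simp [Pi.single_eq_of_ne hj]) (by simp)]
  simp only [Pi.single_eq_same, intPoint]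
  push_cast
  ring

/-- The divergence theorem for the field whose only component is `h` in direction `k`: the two faces
orthogonal to `k` cancel by periodicity. -/
theorem integral_fderiv_single_eq_zero {n : ℕ} {h : (Fin (n + 1) → ℝ) → ℂ}
    (hh : IsSmoothPeriodic h) (k : Fin (n + 1)) :
    ∫ θ in piCube (n + 1), fderiv ℝ h θ (Pi.single k 1) = 0 := by
  have hd : Differentiable ℝ h := hh.1.differentiable (by simp)
  have hle : (fun _ => -Real.pi : Fin (n + 1) → ℝ) ≤ fun _ => Real.pi := fun _ => by
    linarith [Real.pi_pos]
  have hsum : ∀ θ, ∑ i, (if i = k then fderiv ℝ h θ else 0) (Pi.single i 1) =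
      fderiv ℝ h θ (Pi.single k 1) := by
    intro θ
    rw [Finset.sum_eq_single k]
    · simp
    · intro i _ hi
      simp [hi]
    · simp
  have key := integral_divergence_of_hasFDerivAt_off_countable' (fun _ => -Real.pi)
    (fun _ => Real.pi) hle (fun i θ => if i = k then h θ else 0)
    (fun i θ => if i = k then fderiv ℝ h θ else 0) ∅ Set.countable_empty
    (fun i => by
      split_ifs
      · exact hd.continuous.continuousOn
      · exact continuousOn_const)
    (fun θ _ i => by
      by_cases hi : i = k
      · simpa [hi] using (hd θ).hasFDerivAt
      · simpa [hi] using hasFDerivAt_const (0 : ℂ) θ)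
    (by
      simp only [hsum]
      exact (hh.fderiv_apply _).1.continuous.integrableOn_piCube)
  simp only [hsum] at key
  rw [piCube, key]
  refine Finset.sum_eq_zero fun i _ => ?_
  by_cases hi : i = k
  · subst hi
    rw [sub_eq_zero]
    congr 1
    funext x
    have : i.insertNth Real.pi x =
        (i.insertNth (-Real.pi) x : Fin (n + 1) → ℝ) + Pi.single i (2 * Real.pi) := by
      ext j
      refine Fin.succAboveCases i ?_ (fun j => ?_) j
      · simp; ring
      · simp [Fin.succAbove_ne]
    simp only [if_true, this, hh.2]
  · simp [hi]

/-- Integration by parts against `e^{i s·θ}`, with `g' = i ∂_k g`. Iteration gives decay faster than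
any power of `s_k`. -/
theorem IsSmoothPeriodic.exists_mul_cubeCoeff {d : ℕ} {g : (Fin d → ℝ) → ℂ}
    (hg : IsSmoothPeriodic g) (k : Fin d) :
    ∃ g' : (Fin d → ℝ) → ℂ, IsSmoothPeriodic g' ∧
      ∀ s, (s k : ℂ) * cubeCoeff g s = cubeCoeff g' s := by
  obtain ⟨n, rfl⟩ : ∃ n, d = n + 1 := ⟨d - 1, by have := k.pos; omega⟩
  refine ⟨fun θ => Complex.I * fderiv ℝ g θ (Pi.single k 1),
    ⟨contDiff_const.mul (hg.fderiv_apply _).1, fun j θ => ?_⟩, fun s => ?_⟩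
  · have := (hg.fderiv_apply (Pi.single k 1)).2 j θ
    beta_reduce at this ⊢
    rw [this]
  · have h0 := integral_fderiv_single_eq_zero (hg.mul (isSmoothPeriodic_planeWave s)) k
    have hprod : ∀ θ, fderiv ℝ (fun θ => g θ * planeWave (intPoint s) θ) θ (Pi.single k 1) =
        fderiv ℝ g θ (Pi.single k 1) * planeWave (intPoint s) θ +
          Complex.I * s k * (g θ * planeWave (intPoint s) θ) := by
      intro θ
      rw [fderiv_fun_mul (hg.1.differentiable (by simp) θ)
        ((contDiff_planeWave _).differentiable (by simp) θ)]
      simp only [add_apply, smul_apply, smul_eq_mul,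
        fderiv_planeWave_single, intPoint]
      push_cast
      ring
    simp only [hprod] at h0
    have hc1 : Continuous fun θ =>
        fderiv ℝ g θ (Pi.single k 1) * planeWave (intPoint s) θ :=
      (hg.fderiv_apply _).1.continuous.mul (continuous_planeWave _)
    have hc2 : Continuous fun θ => Complex.I * s k * (g θ * planeWave (intPoint s) θ) :=
      continuous_const.mul (hg.1.continuous.mul (continuous_planeWave _))
    rw [integral_add hc1.integrableOn_piCube hc2.integrableOn_piCube, integral_const_mul] at h0
    simp only [cubeCoeff, mul_assoc Complex.I]
    rw [integral_const_mul]
    linear_combination (-Complex.I) * h0 + ((s k : ℂ) * ∫ θ in piCube (n + 1),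
      g θ * planeWave (intPoint s) θ) * Complex.I_mul_I

theorem IsSmoothPeriodic.exists_pow_mul_norm_cubeCoeff_le {d : ℕ} {g : (Fin d → ℝ) → ℂ}
    (hg : IsSmoothPeriodic g) (k : Fin d) (N : ℕ) :
    ∃ C : ℝ, 0 ≤ C ∧ ∀ s, |(s k : ℝ)| ^ N * ‖cubeCoeff g s‖ ≤ C := by
  have h : ∃ g' : (Fin d → ℝ) → ℂ, IsSmoothPeriodic g' ∧
      ∀ s, (s k : ℂ) ^ N * cubeCoeff g s = cubeCoeff g' s := by
    induction N with
    | zero => exact ⟨g, hg, fun s => by simp⟩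
    | succ N ih =>
      obtain ⟨g', hg', h⟩ := ih
      obtain ⟨g'', hg'', h'⟩ := hg'.exists_mul_cubeCoeff k
      exact ⟨g'', hg'', fun s => by rw [← h', ← h, pow_succ]; ring⟩
  obtain ⟨g', -, h⟩ := h
  refine ⟨∫ θ in piCube d, ‖g' θ‖, integral_nonneg fun _ => norm_nonneg _, fun s => ?_⟩
  have h1 := norm_cubeCoeff_le (g := g') s
  rw [← h s, norm_mul, norm_pow] at h1
  simpa using h1

theorem norm_gridPoint_le {d : ℕ} {ε : ℝ} (s : Fin d → ℤ) :
    ‖gridPoint ε s‖ ≤ ∑ k, |ε| * |(s k : ℝ)| := by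
  have h : gridPoint ε s = ∑ k, EuclideanSpace.single k (ε * (s k : ℝ)) := by
    ext i
    simp [gridPoint, Finset.sum_apply, Pi.single_apply]
  rw [h]
  refine (norm_sum_le _ _).trans_eq (Finset.sum_congr rfl fun k _ => ?_)
  simp

theorem IsSmoothPeriodic.isRapidlyDecreasing {d : ℕ} (hd : 0 < d) {g : (Fin d → ℝ) → ℂ}
    (hg : IsSmoothPeriodic g) (ε : ℝ) (c : ℂ) :
    IsRapidlyDecreasing ε (fun s => c * cubeCoeff g s) := by
  intro N
  choose C hC hC' using fun k => hg.exists_pow_mul_norm_cubeCoeff_le k N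
  refine ⟨(d * |ε|) ^ N * ‖c‖ * ∑ k, C k, fun s => ?_⟩
  have : Nonempty (Fin d) := ⟨⟨0, hd⟩⟩
  -- The largest coordinate controls the whole grid point. It depends on `s`, so the final constant
  -- sums over all directions.
  obtain ⟨k, hk⟩ := Finite.exists_max fun k => |(s k : ℝ)|
  have h1 : ‖gridPoint ε s‖ ≤ d * |ε| * |(s k : ℝ)| := by
    refine (norm_gridPoint_le s).trans ((Finset.sum_le_card_nsmul _ _ (|ε| * |(s k : ℝ)|)
      fun j _ => mul_le_mul_of_nonneg_left (hk j) (abs_nonneg _)).trans_eq ?_)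
    simp [mul_assoc]
  calc ‖gridPoint ε s‖ ^ N * ‖c * cubeCoeff g s‖
      ≤ (d * |ε| * |(s k : ℝ)|) ^ N * (‖c‖ * ‖cubeCoeff g s‖) := by rw [norm_mul]; gcongr
    _ = (d * |ε|) ^ N * ‖c‖ * (|(s k : ℝ)| ^ N * ‖cubeCoeff g s‖) := by rw [mul_pow]; ring
    _ ≤ (d * |ε|) ^ N * ‖c‖ * ∑ k, C k := by
        gcongr
        exact (hC' k s).trans (Finset.single_le_sum (fun j _ => hC j) (Finset.mem_univ k))

/-! ### The discrete symbol -/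

theorem contDiff_discreteSymbol {d : ℕ} (a : MvPolynomial (Fin d × Bool) ℂ) :
    ContDiff ℝ ∞ (discreteSymbol a) := by
  have h : ∀ p : Fin d × Bool, ContDiff ℝ ∞
      fun θ : Fin d → ℝ => Complex.exp (signI p.2 * (θ p.1 : ℂ)) - 1 := by
    intro p
    have h1 : ContDiff ℝ ∞ fun θ : Fin d → ℝ => (θ p.1 : ℂ) :=
      Complex.ofRealCLM.contDiff.comp (contDiff_apply ℝ ℝ p.1)
    exact (contDiff_const.mul h1).cexp.sub contDiff_const
  unfold discreteSymbol
  simp only [MvPolynomial.eval_eq]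
  exact ContDiff.sum fun ν _ => contDiff_const.mul (contDiff_prod fun p _ => (h p).pow _)

@[fun_prop]
theorem continuous_discreteSymbol {d : ℕ} (a : MvPolynomial (Fin d × Bool) ℂ) :
    Continuous (discreteSymbol a) := (contDiff_discreteSymbol a).continuous

theorem discreteSymbol_add_single {d : ℕ} (a : MvPolynomial (Fin d × Bool) ℂ) (k : Fin d)
    (θ : Fin d → ℝ) : discreteSymbol a (θ + Pi.single k (2 * Real.pi)) = discreteSymbol a θ := by
  unfold discreteSymbol
  congr 2
  funext p
  congr 1
  by_cases hp : p.1 = k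
  · subst hp
    rw [Complex.exp_eq_exp_iff_exists_int]
    rcases p with ⟨i, b⟩
    cases b
    · exact ⟨-1, by simp [signI]; ring⟩
    · exact ⟨1, by simp [signI]; ring⟩
  · simp [Pi.single_eq_of_ne hp]

/-- A shift by `±e_k` multiplies the integrand by `e^{±iθ_k}`, so the multiplier principle applies
with the algebra of continuous functions on `ℝ^d` as symbols. -/
theorem differenceOpGrid_cubeCoeff {d : ℕ} (l : ℕ) (a : MvPolynomial (Fin d × Bool) ℂ) (ε : ℝ)
    {g : (Fin d → ℝ) → ℂ} (hg : Continuous g) (c : ℂ) (s : Fin d → ℤ) :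
    differenceOpGrid l a ε (fun s => c * cubeCoeff g s) s =
      (((ε ^ l)⁻¹ : ℝ) : ℂ) * (c * cubeCoeff (fun θ => discreteSymbol a θ * g θ) s) := by
  let m : Fin d × Bool → C((Fin d → ℝ), ℂ) := fun p =>
    ⟨fun θ => Complex.exp (signI p.2 * (θ p.1 : ℂ)) - 1, by fun_prop⟩
  have hm : ∀ θ, MvPolynomial.aeval m a θ = discreteSymbol a θ := by
    intro θ
    have h := MvPolynomial.comp_aeval_apply (f := m) (ContinuousMap.evalAlgHom ℂ ℂ θ) a
    rw [MvPolynomial.aeval_eq_eval] at h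
    exact h
  have hp : ∀ (s : Fin d → ℤ) (k : Fin d) (j : ℤ),
      intPoint (s + Pi.single k j) = intPoint s + Pi.single k (j : ℝ) := by
    intro s k j
    ext i
    by_cases hi : i = k
    · subst hi; simp [intPoint]
    · simp [intPoint, hi]
  have hdiff : ∀ (k : Fin d) (j : ℤ) (b : Bool), (∀ θ : Fin d → ℝ,
      Complex.exp (Complex.I * (((j : ℝ) * θ k : ℝ) : ℂ)) = Complex.exp (signI b * θ k)) →
      ∀ g : C((Fin d → ℝ), ℂ), fwdDiff (Pi.single k j) (cubeCoeffMap d g) =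
        cubeCoeffMap d (m (k, b) * g) := by
    intro k j b hb g
    funext s
    have h1 : Continuous fun θ => g θ * planeWave (intPoint (s + Pi.single k j)) θ := by fun_prop
    have h2 : Continuous fun θ => g θ * planeWave (intPoint s) θ := by fun_prop
    rw [fwdDiff, cubeCoeffMap_apply, cubeCoeffMap_apply, cubeCoeffMap_apply, ← integral_sub h1.integrableOn_piCube h2.integrableOn_piCube]
    congr 1
    funext θ
    have hmk : (m (k, b) * g) θ = (Complex.exp (signI b * θ k) - 1) * g θ := rfl
    rw [hp, planeWave_add_left, planeWave_single, hb, hmk]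
    ring
  have hneg : ∀ k : Fin d, -(Pi.single k (1 : ℤ) : Fin d → ℤ) = Pi.single k (-1) := fun k =>
    (Pi.single_neg k 1).symm
  have key := differenceOp_multiplier (cubeCoeffMap d) (e := fun k => Pi.single k (1 : ℤ)) (m := m)
    (fun k => hdiff k 1 true fun θ => by simp [signI])
    (fun k => by
      rw [hneg]
      exact hdiff k (-1) false fun θ => by simp [signI]) l a ε (c • ⟨g, hg⟩) s
  rw [mul_smul_comm, map_smul, map_smul, Pi.smul_apply, smul_eq_mul, cubeCoeffMap_apply] at key
  simp only [ContinuousMap.mul_apply, hm] at key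
  exact key

/-! ### The first discrete Green function as a Fourier integral -/

theorem hasDerivAt_cubeCoeff_exp {d : ℕ} {g B : (Fin d → ℝ) → ℂ} (hg : Continuous g)
    (hB : Continuous B) (s : Fin d → ℤ) (t : ℝ) :
    HasDerivAt (fun t : ℝ => cubeCoeff (fun θ => g θ * Complex.exp (t * B θ)) s)
      (cubeCoeff (fun θ => g θ * B θ * Complex.exp (t * B θ)) s) t := by
  have hc : ∀ (f : (Fin d → ℝ) → ℂ), Continuous f → ∀ t : ℝ,
      Continuous fun θ => f θ * Complex.exp (t * B θ) * planeWave (intPoint s) θ := by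
    intro f hf t
    fun_prop
  -- The dominating function is uniform over times within distance `1` of `t`, where `|τ| ≤ |t| +
  -- 1`.
  have hbd : Continuous fun θ => ‖g θ * B θ‖ * Real.exp ((|t| + 1) * ‖B θ‖) := by fun_prop
  refine (hasDerivAt_integral_of_dominated_loc_of_deriv_le (μ := volume.restrict (piCube d))
    (F' := fun (t : ℝ) θ => g θ * B θ * Complex.exp (t * B θ) * planeWave (intPoint s) θ)
    (Metric.ball_mem_nhds t one_pos)
    (Filter.Eventually.of_forall fun t => (hc g hg t).aestronglyMeasurable)
    (hc g hg t).integrableOn_piCube (hc _ (hg.mul hB) t).aestronglyMeasurable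
    (Filter.Eventually.of_forall fun θ τ hτ => ?_) hbd.integrableOn_piCube
    (Filter.Eventually.of_forall fun θ τ _ => ?_)).2
  · rw [norm_mul, norm_planeWave, mul_one, norm_mul, Complex.norm_exp]
    have h1 : |τ| ≤ |t| + 1 := by
      have h2 : |τ - t| < 1 := hτ
      have h3 := abs_add_le (τ - t) t
      rw [sub_add_cancel] at h3
      linarith
    gcongr
    rw [Complex.re_ofReal_mul]
    calc τ * (B θ).re ≤ |τ * (B θ).re| := le_abs_self _
      _ = |τ| * |(B θ).re| := abs_mul _ _
      _ ≤ (|t| + 1) * ‖B θ‖ := by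
        gcongr
        exact Complex.abs_re_le_norm _
  · have h3 : HasDerivAt (fun t : ℝ => (t : ℂ) * B θ) (B θ) τ := by
      simpa using (Complex.ofRealCLM.hasDerivAt (x := τ)).mul_const (B θ)
    refine ((h3.cexp.const_mul (g θ)).mul_const _).congr_deriv ?_
    ring

/-- The first discrete Green function. -/
def greenFunction {d : ℕ} (l : ℕ) (a : MvPolynomial (Fin d × Bool) ℂ) (ε : ℝ) (s : Fin d → ℤ)
    (t : ℝ) : ℂ :=
  ((2 * Real.pi : ℝ) : ℂ)⁻¹ ^ d * (((ε ^ d)⁻¹ : ℝ) : ℂ) *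
    cubeCoeff (fun θ => Complex.exp (t * -((((ε ^ l)⁻¹ : ℝ) : ℂ) * discreteSymbol a θ))) s

theorem iteratedDeriv_greenFunction {d : ℕ} (l : ℕ) (a : MvPolynomial (Fin d × Bool) ℂ) (ε : ℝ)
    (s : Fin d → ℤ) (J : ℕ) :
    iteratedDeriv J (greenFunction l a ε s) = fun t : ℝ =>
      ((2 * Real.pi : ℝ) : ℂ)⁻¹ ^ d * (((ε ^ d)⁻¹ : ℝ) : ℂ) *
        cubeCoeff (fun θ => (-((((ε ^ l)⁻¹ : ℝ) : ℂ) * discreteSymbol a θ)) ^ J *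
          Complex.exp (t * -((((ε ^ l)⁻¹ : ℝ) : ℂ) * discreteSymbol a θ))) s := by
  induction J with
  | zero =>
    funext t
    simp [greenFunction]
  | succ J ih =>
    rw [iteratedDeriv_succ, ih]
    funext t
    have := (hasDerivAt_cubeCoeff_exp
      (g := fun θ => (-((((ε ^ l)⁻¹ : ℝ) : ℂ) * discreteSymbol a θ)) ^ J)
      (B := fun θ => -((((ε ^ l)⁻¹ : ℝ) : ℂ) * discreteSymbol a θ)) (by fun_prop) (by fun_prop)
      s t).const_mul (((2 * Real.pi : ℝ) : ℂ)⁻¹ ^ d * (((ε ^ d)⁻¹ : ℝ) : ℂ))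
    rw [this.deriv]
    simp only [pow_succ]

theorem contDiff_greenFunction {d : ℕ} (l : ℕ) (a : MvPolynomial (Fin d × Bool) ℂ) (ε : ℝ)
    (s : Fin d → ℤ) : ContDiff ℝ ∞ (greenFunction l a ε s) := by
  refine contDiff_of_differentiable_iteratedDeriv fun J _ => ?_
  rw [iteratedDeriv_greenFunction]
  intro t
  exact ((hasDerivAt_cubeCoeff_exp
    (g := fun θ => (-((((ε ^ l)⁻¹ : ℝ) : ℂ) * discreteSymbol a θ)) ^ J)
    (B := fun θ => -((((ε ^ l)⁻¹ : ℝ) : ℂ) * discreteSymbol a θ)) (by fun_prop) (by fun_prop)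
    s t).const_mul (((2 * Real.pi : ℝ) : ℂ)⁻¹ ^ d * (((ε ^ d)⁻¹ : ℝ) : ℂ))).differentiableAt

theorem isFirstGreen_greenFunction {d : ℕ} (hd : 0 < d) (l : ℕ)
    (a : MvPolynomial (Fin d × Bool) ℂ) (ε : ℝ) : IsFirstGreen l a ε (greenFunction l a ε) where
  rapid t _ := by
    refine IsSmoothPeriodic.isRapidlyDecreasing hd ⟨?_, fun k θ => ?_⟩ ε _
    · exact (contDiff_const.mul (contDiff_const.mul (contDiff_discreteSymbol a)).neg).cexp
    · rw [discreteSymbol_add_single]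
  smooth s := ((contDiff_greenFunction l a ε s).of_le (by exact_mod_cast le_top)).contDiffOn
  equation s t _ := by
    have h := congrFun (iteratedDeriv_greenFunction l a ε s 1) t
    rw [iteratedDeriv_one] at h
    rw [h]
    have h2 := differenceOpGrid_cubeCoeff l a ε
      (g := fun θ => Complex.exp (t * -((((ε ^ l)⁻¹ : ℝ) : ℂ) * discreteSymbol a θ)))
      (by fun_prop) (((2 * Real.pi : ℝ) : ℂ)⁻¹ ^ d * (((ε ^ d)⁻¹ : ℝ) : ℂ)) s
    have h3 : differenceOpGrid l a ε (fun s' => greenFunction l a ε s' t) s = _ := h2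
    rw [h3]
    have h4 : cubeCoeff (fun θ => (-((((ε ^ l)⁻¹ : ℝ) : ℂ) * discreteSymbol a θ)) ^ 1 *
          Complex.exp (t * -((((ε ^ l)⁻¹ : ℝ) : ℂ) * discreteSymbol a θ))) s =
        -(((ε ^ l)⁻¹ : ℝ) : ℂ) * cubeCoeff (fun θ => discreteSymbol a θ *
          Complex.exp (t * -((((ε ^ l)⁻¹ : ℝ) : ℂ) * discreteSymbol a θ))) s := by
      simp only [cubeCoeff]
      rw [← integral_const_mul]
      congr 1
      funext θ
      ring
    rw [h4]
    ring
  initial s := by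
    have h : greenFunction l a ε s 0 = ((2 * Real.pi : ℝ) : ℂ)⁻¹ ^ d * (((ε ^ d)⁻¹ : ℝ) : ℂ) *
        cubeCoeff (fun _ => 1) s := by simp [greenFunction]
    rw [h, cubeCoeff_one]
    split_ifs
    · have : ((2 * Real.pi : ℝ) : ℂ) ≠ 0 := by
        exact_mod_cast (mul_pos two_pos Real.pi_pos).ne'
      rw [inv_pow, mul_right_comm, inv_mul_cancel₀ (pow_ne_zero _ this), one_mul]
    · simp

end

/-! ### Uniqueness of the Green function by a Baire category argument. -/

noncomputable section

/-! ### Bounded linear evolution equations with pointwise bounded solutions -/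

/-- `w` is continuous in time and solves `w' = D w` for `t > 0` in every coordinate, `D` does not
increase the supremum norm by more than the factor `L`, and `w` is bounded at every time `t ≥ 0`. -/
structure IsBoundedEvolution {S : Type*} (D : (S → ℂ) → S → ℂ) (L : ℝ) (w : S → ℝ → ℂ) :
    Prop where
  nonneg : 0 ≤ L
  bound : ∀ (u : S → ℂ) (B : ℝ), (∀ s, ‖u s‖ ≤ B) → ∀ s, ‖D u s‖ ≤ L * B
  cont : ∀ s, ContinuousOn (w s) (Set.Ici 0)
  deriv : ∀ s t, 0 < t → HasDerivAt (w s) (D (fun s' => w s' t) s) t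
  bdd : ∀ t, 0 ≤ t → ∃ B, ∀ s, ‖w s t‖ ≤ B

namespace IsBoundedEvolution

open Set

variable {S : Type*} {D : (S → ℂ) → S → ℂ} {L : ℝ} {w : S → ℝ → ℂ}

theorem norm_sub_le_of_le (hw : IsBoundedEvolution D L w) {x y C : ℝ} (hx : 0 ≤ x) (hxy : x ≤ y)
    (hC : ∀ t ∈ Icc x y, ∀ s, ‖w s t‖ ≤ C) (s : S) : ‖w s y - w s x‖ ≤ L * C * (y - x) := by
  have hpos : ∀ x', 0 < x' → x ≤ x' → x' ≤ y → ‖w s y - w s x'‖ ≤ L * C * (y - x') := by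
    intro x' hx' hxx' hx'y
    refine norm_image_sub_le_of_norm_deriv_right_le_segment
      ((hw.cont s).mono fun t ht => hx'.le.trans ht.1)
      (fun t ht => (hw.deriv s t (hx'.trans_le ht.1)).hasDerivWithinAt)
      (fun t ht => hw.bound _ C (hC t ⟨hxx'.trans ht.1, ht.2.le⟩) s) y (right_mem_Icc.2 hx'y)
  -- The equation is available for positive times only; an interval starting at `0` is reached as a
  -- limit, by continuity.
  rcases hx.eq_or_lt with rfl | hx
  · rcases hxy.eq_or_lt with rfl | hy
    · simp
    have h1 : Filter.Tendsto (fun x' => ‖w s y - w s x'‖) (nhdsWithin 0 (Ioi 0))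
        (nhds ‖w s y - w s 0‖) :=
      (tendsto_const_nhds.sub ((hw.cont s 0 self_mem_Ici).mono_left
        (nhdsWithin_mono _ Ioi_subset_Ici_self))).norm
    have h2 : Filter.Tendsto (fun x' => L * C * (y - x')) (nhdsWithin 0 (Ioi 0))
        (nhds (L * C * (y - 0))) := by
      have hc : Continuous fun x' => L * C * (y - x') := by fun_prop
      exact (hc.tendsto 0).mono_left nhdsWithin_le_nhds
    refine le_of_tendsto_of_tendsto h1 h2 ?_
    filter_upwards [Ioc_mem_nhdsGT hy] with x' hx'
    exact hpos x' hx'.1 hx'.1.le hx'.2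
  · exact hpos x hx le_rfl hxy

theorem norm_sub_le (hw : IsBoundedEvolution D L w) {p q C : ℝ} (hp : 0 ≤ p) (hq : 0 ≤ q)
    (hC : ∀ t ∈ uIcc p q, ∀ s, ‖w s t‖ ≤ C) (s : S) : ‖w s q - w s p‖ ≤ L * C * |q - p| := by
  rcases le_total p q with h | h
  · rw [uIcc_of_le h] at hC
    rw [abs_of_nonneg (sub_nonneg.2 h)]
    exact hw.norm_sub_le_of_le hp h hC s
  · rw [uIcc_of_ge h] at hC
    rw [abs_sub_comm, abs_of_nonneg (sub_nonneg.2 h), norm_sub_rev]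
    exact hw.norm_sub_le_of_le hq h hC s

/-- On a short time interval a bounded solution is at most twice as large as at an end point. -/
theorem norm_le_two_mul (hw : IsBoundedEvolution D L w) {p q C W : ℝ} (hp : 0 ≤ p) (hq : 0 ≤ q)
    (hpq : L * |q - p| ≤ 1 / 2) (hC : ∀ t ∈ uIcc p q, ∀ s, ‖w s t‖ ≤ C)
    (hW : ∀ s, ‖w s p‖ ≤ W) : ∀ t ∈ uIcc p q, ∀ s, ‖w s t‖ ≤ 2 * W := by
  have hnonneg : ∀ t ∈ uIcc p q, 0 ≤ t := fun t ht => (le_inf hp hq).trans ht.1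
  -- A uniform bound `B` improves to `W + B/2`, whose fixed point is `2W`. The a priori bound `C`
  -- must be finite, but its influence fades like `2^{-n}`.
  have key : ∀ n : ℕ, ∀ t ∈ uIcc p q, ∀ s, ‖w s t‖ ≤ 2 * W + C * (1 / 2) ^ n := by
    intro n
    induction n with
    | zero =>
      intro t ht s
      have := (norm_nonneg _).trans (hW s)
      linarith [hC t ht s]
    | succ n ih =>
      intro t ht s
      have h1 := hw.norm_sub_le hp (hnonneg t ht)
        (fun r hr => ih r (uIcc_subset_uIcc left_mem_uIcc ht hr)) s
      have hB : 0 ≤ 2 * W + C * (1 / 2) ^ n := (norm_nonneg _).trans (ih t ht s)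
      have h2 : |t - p| ≤ |q - p| := abs_sub_left_of_mem_uIcc ht
      have h3 : L * (2 * W + C * (1 / 2) ^ n) * |t - p| ≤ (2 * W + C * (1 / 2) ^ n) / 2 :=
        calc L * (2 * W + C * (1 / 2) ^ n) * |t - p|
            = (2 * W + C * (1 / 2) ^ n) * (L * |t - p|) := by ring
          _ ≤ (2 * W + C * (1 / 2) ^ n) * (1 / 2) := by
              gcongr
              exact (mul_le_mul_of_nonneg_left h2 hw.nonneg).trans hpq
          _ = _ := by ring
      have h4 : ‖w s t‖ ≤ ‖w s t - w s p‖ + ‖w s p‖ := by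
        simpa using norm_add_le (w s t - w s p) (w s p)
      calc ‖w s t‖ ≤ (2 * W + C * (1 / 2) ^ n) / 2 + W := by linarith [hW s]
        _ = _ := by rw [pow_succ]; ring
  intro t ht s
  have hlim : Filter.Tendsto (fun n : ℕ => 2 * W + C * (1 / 2 : ℝ) ^ n) Filter.atTop
      (nhds (2 * W + C * 0)) :=
    ((tendsto_pow_atTop_nhds_zero_of_lt_one (by norm_num) (by norm_num)).const_mul C).const_add _
  simpa using ge_of_tendsto' hlim fun n => key n t ht s

theorem exists_bound_of_locally {A : Set ℝ} (hA : IsCompact A)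
    (h : ∀ t ∈ A, ∃ C, ∀ᶠ τ in nhdsWithin t A, ∀ s, ‖w s τ‖ ≤ C) :
    ∃ C, ∀ t ∈ A, ∀ s, ‖w s t‖ ≤ C := by
  refine hA.induction_on (p := fun B => ∃ C, ∀ t ∈ B, ∀ s, ‖w s t‖ ≤ C) ⟨0, by simp⟩ ?_ ?_ ?_
  · rintro B B' hB ⟨C, hC⟩
    exact ⟨C, fun t ht => hC t (hB ht)⟩
  · rintro B B' ⟨C, hC⟩ ⟨C', hC'⟩
    refine ⟨max C C', fun t ht s => ?_⟩
    rcases ht with ht | ht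
    · exact (hC t ht s).trans (le_max_left _ _)
    · exact (hC' t ht s).trans (le_max_right _ _)
  · intro t ht
    obtain ⟨C, hC⟩ := h t ht
    exact ⟨_, hC, C, fun τ hτ => hτ⟩

/-- By the Baire category theorem a pointwise bounded solution is bounded on short intervals. -/
theorem exists_bound (hw : IsBoundedEvolution D L w) {x y : ℝ} (hx : 0 ≤ x)
    (hxy : L * (y - x) ≤ 1 / 2) : ∃ C, ∀ t ∈ Icc x y, ∀ s, ‖w s t‖ ≤ C := by
  let good : ℝ → Prop := fun t => ∃ C, ∀ᶠ τ in nhdsWithin t (Icc x y), ∀ s, ‖w s τ‖ ≤ C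
  refine exists_bound_of_locally isCompact_Icc ?_
  by_contra hF
  -- The times near which no uniform bound holds form a closed set. If it is nonempty, Baire's
  -- theorem is applied to this set itself, not to the whole interval.
  let F : Set ℝ := {t ∈ Icc x y | ¬ good t}
  have hne : F.Nonempty := by
    simp only [not_forall] at hF
    obtain ⟨t, ht, hF⟩ := hF
    exact ⟨t, ht, hF⟩
  have hnn : ∀ t ∈ Icc x y, 0 ≤ t := fun t ht => hx.trans ht.1
  have hFclosed : IsClosed F := by
    refine isClosed_of_closure_subset fun t ht => ?_
    have htI : t ∈ Icc x y := closure_minimal (fun r hr => hr.1) isClosed_Icc ht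
    refine ⟨htI, ?_⟩
    rintro ⟨C, hC⟩
    rw [← eventually_eventually_nhdsWithin] at hC
    obtain ⟨U, hU, hUt⟩ := mem_nhdsWithin_iff_exists_mem_nhds_inter.1 hC
    obtain ⟨r, hrU, hrF⟩ := mem_closure_iff_nhds.1 ht U hU
    exact hrF.2 ⟨C, hUt ⟨hrU, hrF.1⟩⟩
  have hFcompact : IsCompact F := isCompact_Icc.of_isClosed_subset hFclosed fun r hr => hr.1
  have : CompleteSpace F := hFclosed.completeSpace_coe
  have : Nonempty F := hne.to_subtype
  -- On some relatively open portion of `F` around `t₀` the solution is bounded by one number `n`.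
  -- The contradiction will be that `t₀` is good, with bound `2n`.
  obtain ⟨n, t₀, ht₀⟩ := nonempty_interior_of_iUnion_of_closed
    (f := fun n : ℕ => {t : F | ∀ s, ‖w s t‖ ≤ n}) (fun n => by
      simp only [ofPred_forall]
      refine isClosed_iInter fun s => ?_
      have hc : Continuous fun t : F => w s t :=
        ((hw.cont s).mono fun t ht => hnn t ht.1).domRestrict
      exact isClosed_le hc.norm continuous_const)
    (eq_univ_of_forall fun t => by
      obtain ⟨B, hB⟩ := hw.bdd t (hnn t t.2.1)
      obtain ⟨n, hn⟩ := exists_nat_ge B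
      exact mem_iUnion.2 ⟨n, fun s => (hB s).trans hn⟩)
  obtain ⟨δ, hδ, hball⟩ := Metric.isOpen_iff.1 isOpen_interior t₀ ht₀
  have hn : ∀ t ∈ F, |t - t₀| < δ → ∀ s, ‖w s t‖ ≤ n := fun t ht htd =>
    interior_subset (hball (show (⟨t, ht⟩ : F) ∈ Metric.ball t₀ δ from htd))
  refine t₀.2.2 ⟨2 * n, ?_⟩
  filter_upwards [self_mem_nhdsWithin, mem_nhdsWithin_of_mem_nhds (Metric.ball_mem_nhds _ hδ)]
    with τ hτ hτδ
  -- Let `b` be the bad time between `t₀` and `τ` that is nearest to `τ`: the bound `n` holds at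
  -- `b`, and every other time between `b` and `τ` is good.
  obtain ⟨b, ⟨hbF, hbt⟩, hbmin⟩ := (hFcompact.inter_right isCompact_uIcc.isClosed).exists_isMinOn
    (s := F ∩ uIcc (t₀ : ℝ) τ) ⟨t₀, t₀.2, left_mem_uIcc⟩
    (f := fun r => |r - τ|) (by fun_prop)
  have hbn : ∀ s, ‖w s b‖ ≤ n := by
    refine hn b hbF (lt_of_le_of_lt ?_ hτδ)
    exact abs_sub_left_of_mem_uIcc hbt
  have hsub : ∀ r ∈ Icc x y, uIcc r τ ⊆ Icc x y := fun r hr =>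
    (convex_Icc x y).ordConnected.uIcc_subset hr hτ
  have hgood : ∀ r ∈ uIcc b τ, r ≠ b → good r := by
    intro r hr hrb
    by_contra hrF
    have h1 : r ∈ F ∩ uIcc (t₀ : ℝ) τ :=
      ⟨⟨hsub b hbF.1 hr, hrF⟩, uIcc_subset_uIcc hbt right_mem_uIcc hr⟩
    have h2 : |b - τ| ≤ |r - τ| := hbmin h1
    refine hrb ?_
    rcases mem_uIcc.1 hr with h | h
    · rw [abs_of_nonpos (by linarith [h.1, h.2]), abs_of_nonpos (by linarith [h.1, h.2])] at h2
      linarith [h.1]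
    · rw [abs_of_nonneg (by linarith [h.1, h.2]), abs_of_nonneg (by linarith [h.1, h.2])] at h2
      linarith [h.2]
  have hshort : ∀ p ∈ Icc x y, ∀ q ∈ Icc x y, L * |q - p| ≤ 1 / 2 := fun p hp q hq =>
    (mul_le_mul_of_nonneg_left (abs_sub_le_iff.2 ⟨by linarith [hp.1, hq.2], by linarith [hq.1, hp.2]⟩)
      hw.nonneg).trans hxy
  obtain ⟨W, hW⟩ := hw.bdd τ (hnn τ hτ)
  -- The stretch between `τ` and `r` consists of good times, so it carries some finite bound.
  -- Propagating from `τ` replaces it by `2W`, which does not depend on how close `r` is to `b`.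
  have hbd : ∀ r ∈ uIcc b τ, r ≠ b → ∀ s, ‖w s r‖ ≤ 2 * W := by
    intro r hr hrb
    have hrI : r ∈ Icc x y := hsub b hbF.1 hr
    have hnb : b ∉ uIcc τ r := by
      intro hb
      refine hrb ?_
      rcases mem_uIcc.1 hr with h | h <;> rcases mem_uIcc.1 hb with h' | h' <;>
        linarith [h.1, h.2, h'.1, h'.2]
    have hss : uIcc τ r ⊆ Icc x y := by rw [uIcc_comm]; exact hsub r hrI
    obtain ⟨C, hC⟩ := exists_bound_of_locally (w := w) (isCompact_uIcc (a := τ) (b := r))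
      fun t ht => by
        obtain ⟨C, hC⟩ := hgood t (uIcc_subset_uIcc right_mem_uIcc hr ht) fun h => hnb (h ▸ ht)
        exact ⟨C, hC.filter_mono (nhdsWithin_mono _ hss)⟩
    exact hw.norm_le_two_mul (hnn τ hτ) (hnn r hrI) (hshort τ hτ r hrI) hC hW r right_mem_uIcc
  -- The whole stretch, `b` included, is now bounded, so propagation from `b` gives `2n` at `τ`. The
  -- bound `W`, which depends on `τ`, has disappeared.
  refine hw.norm_le_two_mul (C := max (2 * W) n) (hnn b hbF.1) (hnn τ hτ) (hshort b hbF.1 τ hτ)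
    (fun r hr s => ?_) hbn τ right_mem_uIcc
  by_cases hrb : r = b
  · exact hrb ▸ (hbn s).trans (le_max_right _ _)
  · exact (hbd r hr hrb s).trans (le_max_left _ _)

theorem eq_zero (hw : IsBoundedEvolution D L w) (h0 : ∀ s, w s 0 = 0) {t : ℝ} (ht : 0 ≤ t) (s : S) :
    w s t = 0 := by
  -- A step short enough for `L h ≤ 1/2`, with `L + 1` because `L` may be `0`. On each step the
  -- doubling estimate with initial bound `W = 0` gives zero.
  set h : ℝ := 1 / (2 * (L + 1))
  have hL : 0 < L + 1 := by linarith [hw.nonneg]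
  have hh : 0 < h := by positivity
  have hLh : L * h ≤ 1 / 2 := by
    rw [mul_one_div, div_le_div_iff₀ (by positivity) two_pos]
    linarith
  have key : ∀ n : ℕ, ∀ t ∈ Icc (0 : ℝ) (n * h), ∀ s, w s t = 0 := by
    intro n
    induction n with
    | zero =>
      intro t ht s
      have : t = 0 := le_antisymm (by simpa using ht.2) ht.1
      rw [this, h0]
    | succ n ih =>
      intro t ht s
      have hn : 0 ≤ n * h := by positivity
      rcases le_total t (n * h) with h1 | h1
      · exact ih t ⟨ht.1, h1⟩ s
      · have h2 : n * h + h = (n + 1 : ℕ) * h := by push_cast; ring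
        obtain ⟨C, hC⟩ := hw.exists_bound (x := n * h) (y := n * h + h) hn (by simpa using hLh)
        have h3 := hw.norm_le_two_mul (p := n * h) (q := n * h + h) (C := C) (W := 0) hn
          (by positivity) (by simpa [abs_of_pos hh] using hLh)
          (by rwa [uIcc_of_le (by linarith)])
          (fun s => by rw [ih _ ⟨hn, le_rfl⟩ s]; simp) t
          (by rw [uIcc_of_le (by linarith)]; exact ⟨h1, h2 ▸ ht.2⟩) s
        simpa using h3
  obtain ⟨n, hn⟩ := exists_nat_ge (t / h)
  exact key n t ⟨ht, (div_le_iff₀ hh).1 hn⟩ s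

end IsBoundedEvolution

/-! ### Difference operators are bounded and linear -/

theorem exists_norm_foldr_le {ι G : Type*} (T : ι → (G → ℂ) → G → ℂ)
    (hT : ∀ k, ∃ c : ℝ, 0 ≤ c ∧ ∀ u B, (∀ y, ‖u y‖ ≤ B) → ∀ y, ‖T k u y‖ ≤ c * B) (L : List ι) :
    ∃ c : ℝ, 0 ≤ c ∧ ∀ u B, (∀ y, ‖u y‖ ≤ B) → ∀ y, ‖L.foldr T u y‖ ≤ c * B := by
  induction L with
  | nil => exact ⟨1, zero_le_one, fun u B h y => by simpa using h y⟩
  | cons k L ih =>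
    obtain ⟨c, hc, h⟩ := ih
    obtain ⟨c', hc', h'⟩ := hT k
    refine ⟨c' * c, by positivity, fun u B hu y => ?_⟩
    rw [List.foldr_cons, mul_assoc]
    exact h' _ _ (h u B hu) y

theorem norm_iterate_fwdDiff_le {G : Type*} [AddCommGroup G] (e : G) (n : ℕ) (u : G → ℂ) (B : ℝ)
    (hu : ∀ y, ‖u y‖ ≤ B) (y : G) : ‖(fwdDiff e)^[n] u y‖ ≤ 2 ^ n * B := by
  induction n generalizing y with
  | zero => simpa using hu y
  | succ n ih =>
    rw [Function.iterate_succ_apply']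
    calc ‖(fwdDiff e)^[n] u (y + e) - (fwdDiff e)^[n] u y‖ ≤ 2 ^ n * B + 2 ^ n * B :=
          norm_sub_le_of_le (ih _) (ih _)
      _ = _ := by ring

theorem exists_norm_differenceOp_le {d : ℕ} {G : Type*} [AddCommGroup G] (l : ℕ)
    (a : MvPolynomial (Fin d × Bool) ℂ) (ε : ℝ) (e : Fin d → G) :
    ∃ L : ℝ, 0 ≤ L ∧ ∀ u B, (∀ y, ‖u y‖ ≤ B) → ∀ y, ‖differenceOp l a ε e u y‖ ≤ L * B := by
  choose c hc h using fun ν : Fin d × Bool →₀ ℕ => exists_norm_foldr_le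
    (fun k (f : G → ℂ) => (fwdDiff (-e k))^[ν (k, false)] ((fwdDiff (e k))^[ν (k, true)] f))
    (fun k => ⟨2 ^ ν (k, false) * 2 ^ ν (k, true), by positivity, fun u B hu y => by
      rw [mul_assoc]
      exact norm_iterate_fwdDiff_le _ _ _ _ (norm_iterate_fwdDiff_le _ _ _ _ hu) y⟩)
    (List.finRange d)
  refine ⟨|(ε ^ l)⁻¹| * ∑ ν ∈ a.support, ‖a.coeff ν‖ * c ν,
    mul_nonneg (abs_nonneg _) (Finset.sum_nonneg fun ν _ => mul_nonneg (norm_nonneg _) (hc ν)),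
    fun u B hu y => ?_⟩
  rw [differenceOp, norm_mul, Complex.norm_real, Real.norm_eq_abs, mul_assoc, Finset.sum_mul]
  gcongr
  refine (norm_sum_le _ _).trans (Finset.sum_le_sum fun ν _ => ?_)
  rw [norm_mul, mul_assoc]
  gcongr
  exact h ν u B hu y

theorem iterate_fwdDiff_sub {G : Type*} [AddCommGroup G] (e : G) (n : ℕ) (u v : G → ℂ) :
    (fwdDiff e)^[n] (u - v) = (fwdDiff e)^[n] u - (fwdDiff e)^[n] v := by
  induction n with
  | zero => rfl
  | succ n ih =>
    simp only [Function.iterate_succ_apply', ih]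
    funext y
    simp only [fwdDiff, Pi.sub_apply]
    ring

theorem differenceOp_sub {d : ℕ} {G : Type*} [AddCommGroup G] (l : ℕ)
    (a : MvPolynomial (Fin d × Bool) ℂ) (ε : ℝ) (e : Fin d → G) (u v : G → ℂ) (y : G) :
    differenceOp l a ε e (u - v) y = differenceOp l a ε e u y - differenceOp l a ε e v y := by
  have h : ∀ (ν : Fin d × Bool →₀ ℕ) (L : List (Fin d)),
      L.foldr (fun k f => (fwdDiff (-e k))^[ν (k, false)] ((fwdDiff (e k))^[ν (k, true)] f)) (u - v) =
      L.foldr (fun k f => (fwdDiff (-e k))^[ν (k, false)] ((fwdDiff (e k))^[ν (k, true)] f)) u -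
      L.foldr (fun k f => (fwdDiff (-e k))^[ν (k, false)] ((fwdDiff (e k))^[ν (k, true)] f)) v := by
    intro ν L
    induction L with
    | nil => rfl
    | cons k L ih => simp only [List.foldr_cons, ih, iterate_fwdDiff_sub]
  simp only [differenceOp, h, Pi.sub_apply, mul_sub, Finset.sum_sub_distrib]

/-! ### Uniqueness of the first discrete Green function -/

theorem IsRapidlyDecreasing.exists_norm_le {d : ℕ} {ε : ℝ} {u : (Fin d → ℤ) → ℂ}
    (h : IsRapidlyDecreasing ε u) : ∃ B, ∀ s, ‖u s‖ ≤ B := by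
  obtain ⟨C, hC⟩ := h 0
  exact ⟨C, fun s => by simpa using hC s⟩

theorem IsFirstGreen.hasDerivAt {d l : ℕ} {a : MvPolynomial (Fin d × Bool) ℂ} {ε : ℝ}
    {u : (Fin d → ℤ) → ℝ → ℂ} (h : IsFirstGreen l a ε u) (s : Fin d → ℤ) {t : ℝ} (ht : 0 < t) :
    HasDerivAt (u s) (-differenceOpGrid l a ε (fun s' => u s' t) s) t := by
  have h1 : DifferentiableAt ℝ (u s) t :=
    (h.smooth s).differentiableOn (by simp) |>.differentiableAt (Ici_mem_nhds ht)
  have h2 := h1.hasDerivAt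
  rwa [eq_neg_of_add_eq_zero_left (h.equation s t ht)] at h2

/-- Difference operators are bounded in the supremum norm, and rapid decay at a fixed time gives
boundedness at that time, which is all that the evolution argument requires. -/
theorem IsFirstGreen.eq {d l : ℕ} {a : MvPolynomial (Fin d × Bool) ℂ} {ε : ℝ}
    {u v : (Fin d → ℤ) → ℝ → ℂ} (hu : IsFirstGreen l a ε u) (hv : IsFirstGreen l a ε v)
    (s : Fin d → ℤ) {t : ℝ} (ht : 0 ≤ t) : v s t = u s t := by
  obtain ⟨L, hL, hbound⟩ := exists_norm_differenceOp_le l a ε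
    (fun k : Fin d => (Pi.single k 1 : Fin d → ℤ))
  have hw : IsBoundedEvolution (fun f s => -differenceOpGrid l a ε f s) L
      (fun s t => v s t - u s t) :=
    { nonneg := hL
      bound := fun f B hf s => by
        rw [norm_neg]
        exact hbound f B hf s
      cont := fun s => (hv.smooth s).continuousOn.sub (hu.smooth s).continuousOn
      deriv := fun s t ht => by
        refine ((hv.hasDerivAt s ht).sub (hu.hasDerivAt s ht)).congr_deriv ?_
        have h := differenceOp_sub l a ε (fun k : Fin d => (Pi.single k 1 : Fin d → ℤ))
          (fun s => v s t) (fun s => u s t) s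
        change _ = -differenceOp l a ε _ ((fun s => v s t) - fun s => u s t) s
        rw [h]
        simp only [differenceOpGrid]
        ring
      bdd := fun t ht => by
        obtain ⟨B, hB⟩ := (hv.rapid t ht).exists_norm_le
        obtain ⟨B', hB'⟩ := (hu.rapid t ht).exists_norm_le
        exact ⟨B + B', fun s => norm_sub_le_of_le (hB s) (hB' s)⟩ }
  refine sub_eq_zero.1 (hw.eq_zero (fun s => ?_) ht s)
  rw [hv.initial, hu.initial, sub_self]

end

/-! ### Lower bound for the discrete symbol and estimate of the expansion remainder. -/

noncomputable section

open MeasureTheory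
open scoped Pointwise

/-! ### The quantitative ellipticity of the discrete symbol -/

theorem discreteSymbol_zero {d : ℕ} (a : MvPolynomial (Fin d × Bool) ℂ) :
    discreteSymbol a 0 = MvPolynomial.coeff 0 a := by
  have h : (fun p : Fin d × Bool =>
      Complex.exp (signI p.2 * (((0 : Fin d → ℝ) p.1 : ℝ) : ℂ)) - 1) = 0 := by
    funext p
    simp
  rw [discreteSymbol, h, MvPolynomial.eval_zero, MvPolynomial.constantCoeff_eq]

/-- Near the origin `z^{-l} A(zξ) = P(ξ) + O(z)` on the unit sphere, so strong ellipticity of `P`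
survives with half its constant. Elsewhere in the cube, compactness bounds the positive real part
from below. -/
theorem exists_le_re_discreteSymbol {d l M : ℕ} (hl : 0 < l) (hM : 0 < M)
    {P : MvPolynomial (Fin d) ℂ} (hP : IsStronglyElliptic l P)
    {a : MvPolynomial (Fin d × Bool) ℂ} (h : IsApproximation l a P M)
    (ha₀ : MvPolynomial.coeff 0 a = 0) (ha : IsDiscreteElliptic a) :
    ∃ c : ℝ, 0 < c ∧ ∀ θ ∈ piCube d, c * ‖θ‖ ^ l ≤ (discreteSymbol a θ).re := by
  obtain ⟨c, hc, hPc⟩ := hP.exists_le_evalReal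
  obtain ⟨C, N, hC, hexp⟩ := hasExpansion_scaledSymbol hM h 1 1
  set C' := C * 2 ^ N
  have hC' : 0 ≤ C' := by positivity
  -- Chosen so that the error `C' z` is at most `c/2`; the `1` keeps `z` in the range of the
  -- expansion, and `C' + 1` avoids dividing by zero. The factor `2^N` in `C'` is `(1 + |ξ|)^N` at
  -- `|ξ| = 1`.
  set r := min 1 (c / (2 * (C' + 1)))
  have hr : 0 < r := lt_min one_pos (by positivity)
  have hnear : ∀ θ : Fin d → ℝ, θ ≠ 0 → ‖θ‖ ≤ r →
      c / 2 * ‖θ‖ ^ l ≤ (discreteSymbol a θ).re := by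
    intro θ hθ hθr
    set z := ‖θ‖
    have hz : 0 < z := norm_pos_iff.2 hθ
    set ξ := z⁻¹ • θ
    have hξ : ‖ξ‖ = 1 := by
      rw [norm_smul, norm_inv, norm_norm]
      exact inv_mul_cancel₀ hz.ne'
    have hzξ : z • ξ = θ := smul_inv_smul₀ hz.ne' θ
    have h1 : ‖((z : ℂ) ^ l)⁻¹ * discreteSymbol a (z • ξ) - truncEval (scaledSeries l a) 1 z ξ‖ ≤ _ :=
      hexp z hz (hθr.trans (min_le_left _ _)) ξ
    have h2 : truncEval (scaledSeries l a) 1 z ξ = evalReal P ξ := by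
      simp only [truncEval, Finset.sum_range_one, pow_zero, one_mul, coeff_scaledSeries hM h hM]
      rfl
    rw [h2, hzξ, hξ, one_add_one_eq_two, pow_one] at h1
    have h3 := hPc ξ
    rw [hξ, one_pow, mul_one] at h3
    have h4 := (Complex.abs_re_le_norm _).trans h1
    have h5 : (((z : ℂ) ^ l)⁻¹ * discreteSymbol a θ).re = (z ^ l)⁻¹ * (discreteSymbol a θ).re := by
      rw [← Complex.ofReal_pow, ← Complex.ofReal_inv, Complex.re_ofReal_mul]
    rw [Complex.sub_re, h5, abs_le] at h4
    have h6 : C' * z ≤ c / 2 := by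
      have h7 : z ≤ c / (2 * (C' + 1)) := hθr.trans (min_le_right _ _)
      rw [le_div_iff₀ (by positivity)] at h7
      nlinarith
    have h7 : c / 2 ≤ (z ^ l)⁻¹ * (discreteSymbol a θ).re := by
      have : C * z * 2 ^ N = C' * z := by ring
      linarith [h4.1]
    rwa [inv_mul_eq_div, le_div_iff₀ (by positivity)] at h7
  have hK : IsCompact (piCube d ∩ {θ | r ≤ ‖θ‖}) :=
    (isCompact_piCube d).inter_right (isClosed_le continuous_const continuous_norm)
  have hfar : ∃ m : ℝ, 0 < m ∧ ∀ θ ∈ piCube d, r ≤ ‖θ‖ → m ≤ (discreteSymbol a θ).re := by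
    rcases (piCube d ∩ {θ | r ≤ ‖θ‖}).eq_empty_or_nonempty with h0 | h0
    · exact ⟨1, one_pos, fun θ hθ hr => (Set.eq_empty_iff_forall_notMem.1 h0 θ ⟨hθ, hr⟩).elim⟩
    · obtain ⟨θ₀, hθ₀, hmin⟩ := hK.exists_isMinOn h0
        (f := fun θ => (discreteSymbol a θ).re) (by fun_prop)
      exact ⟨_, ha θ₀ (mem_piCube_iff.1 hθ₀.1) (norm_pos_iff.1 (hr.trans_le hθ₀.2)),
        fun θ hθ hr => hmin ⟨hθ, hr⟩⟩
  obtain ⟨m, hm, hfar⟩ := hfar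
  refine ⟨min (c / 2) (m / Real.pi ^ l), lt_min (by positivity) (by positivity), fun θ hθ => ?_⟩
  rcases eq_or_ne θ 0 with rfl | h0
  · simp [discreteSymbol_zero, ha₀, hl.ne']
  rcases le_total ‖θ‖ r with h1 | h1
  · refine le_trans ?_ (hnear θ h0 h1)
    gcongr
    exact min_le_left _ _
  · refine le_trans ?_ (hfar θ hθ h1)
    have h2 : ‖θ‖ ≤ Real.pi :=
      (pi_norm_le_iff_of_nonneg Real.pi_pos.le).2 (mem_piCube_iff.1 hθ)
    calc min (c / 2) (m / Real.pi ^ l) * ‖θ‖ ^ l ≤ m / Real.pi ^ l * Real.pi ^ l := by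
          gcongr
          exact min_le_right _ _
      _ = m := div_mul_cancel₀ _ (by positivity)

/-! ### The remainder of the expansion in frequency space -/

/-- The scaled symbol `z^{-l} A(zξ)`. -/
def scaledSymbol {d : ℕ} (l : ℕ) (a : MvPolynomial (Fin d × Bool) ℂ) (z : ℝ)
    (ξ : Fin d → ℝ) : ℂ :=
  ((z : ℂ) ^ l)⁻¹ * discreteSymbol a (z • ξ)

/-- The difference of the rescaled integrand of the Green function, cut off to the rescaled cube,
and the first `n` terms of its expansion. -/
def expansionRemainder {d : ℕ} (l : ℕ) (a : MvPolynomial (Fin d × Bool) ℂ)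
    (P : MvPolynomial (Fin d) ℂ) (J n : ℕ) (z : ℝ) (ξ : Fin d → ℝ) : ℂ :=
  (z⁻¹ • piCube d).indicator (fun ξ =>
    (-scaledSymbol l a z ξ) ^ J * Complex.exp (-scaledSymbol l a z ξ)) ξ -
  ∑ k ∈ Finset.range n, (z : ℂ) ^ k *
    (evalReal (expansionPoly l a J k) ξ * Complex.exp (-evalReal P ξ))

theorem IsPolyO.norm {d K : ℕ} {z₁ : ℝ} {f : ℝ → (Fin d → ℝ) → ℂ} (hf : IsPolyO z₁ K f) :
    IsPolyO z₁ K (fun z ξ => ((‖f z ξ‖ : ℝ) : ℂ)) := by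
  obtain ⟨C, N, hC, hf⟩ := hf
  exact ⟨C, N, hC, fun z hz hz1 ξ => by simpa using hf z hz hz1 ξ⟩

/-- Three errors of order `z^n` are collected: the tail of the exponential series (`hf₁`), the
surplus powers of `z` in its partial sum (`hf₂`), and the expansion terms outside the enlarged cube
(`hf₃`). -/
theorem exists_norm_expansionRemainder_le {d l M : ℕ} (hl : 0 < l) (hM : 0 < M)
    {P : MvPolynomial (Fin d) ℂ} (hP : IsStronglyElliptic l P)
    {a : MvPolynomial (Fin d × Bool) ℂ} (h : IsApproximation l a P M)
    (ha₀ : MvPolynomial.coeff 0 a = 0) (ha : IsDiscreteElliptic a) (J n : ℕ) (z₁ : ℝ) :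
    ∃ (C : ℝ) (N : ℕ) (c : ℝ), 0 ≤ C ∧ 0 < c ∧ ∀ z, 0 < z → z ≤ z₁ → ∀ ξ,
      ‖expansionRemainder l a P J n z ξ‖ ≤
        C * z ^ n * (1 + ‖ξ‖) ^ N * Real.exp (-(c * ‖ξ‖ ^ l)) := by
  obtain ⟨c₁, hc₁, hell⟩ := exists_le_re_discreteSymbol hl hM hP h ha₀ ha
  obtain ⟨c₂, hc₂, hPc⟩ := hP.exists_le_evalReal
  have hS : HasExpansion z₁ (scaledSymbol l a) (scaledSeries l a) :=
    hasExpansion_scaledSymbol hM h z₁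
  have h0 : PowerSeries.coeff 0 (scaledSeries l a) = P := by
    simpa using coeff_scaledSeries hM h hM
  have hPS : IsPolyO z₁ 1 (fun z ξ => evalReal P ξ - scaledSymbol l a z ξ) :=
    (hS 1).neg.congr fun z _ _ ξ => by simp [truncEval, h0, evalReal]
  have hf₁ : IsPolyO z₁ n
      (fun z ξ => (-scaledSymbol l a z ξ) ^ J * (evalReal P ξ - scaledSymbol l a z ξ) ^ n) := by
    simpa using (hS.isPolyO.neg.pow J).mul (hPS.pow n)
  set F := (-scaledSeries l a) ^ J * ∑ m ∈ Finset.range n, ((m.factorial : ℂ)⁻¹) •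
    (PowerSeries.C (PowerSeries.coeff 0 (scaledSeries l a)) - scaledSeries l a) ^ m
  have hT : HasExpansion z₁ (fun z ξ => (-scaledSymbol l a z ξ) ^ J *
      ∑ m ∈ Finset.range n, ((m.factorial : ℂ)⁻¹) *
        (evalReal P ξ - scaledSymbol l a z ξ) ^ m) F := by
    refine (hS.neg.pow J).mul (HasExpansion.sum _ fun m _ => HasExpansion.const_smul _
      (HasExpansion.pow (HasExpansion.sub ?_ hS) m))
    rw [h0]
    exact HasExpansion.C P
  have hf₂ := hT n
  have htr : IsPolyO z₁ 0 (truncEval F n) :=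
    (hT.isPolyO.sub (hf₂.mono (Nat.zero_le n))).congr fun z _ _ ξ => by ring
  -- The factor `(z(1 + |ξ|))^n` is at least `1` outside the enlarged cube, so inserting it there
  -- gains the order `z^n` at the cost of polynomial growth.
  have hf₃ : IsPolyO z₁ n (fun z ξ => (z : ℂ) ^ n * ((1 + ‖ξ‖ : ℝ) : ℂ) ^ n * truncEval F n z ξ) := by
    have h1 : IsPolyO z₁ 0 (fun _ (ξ : Fin d → ℝ) => ((1 + ‖ξ‖ : ℝ) : ℂ) ^ n) :=
      ⟨1, n, zero_le_one, fun z _ _ ξ => by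
        rw [norm_pow, Complex.norm_real, Real.norm_of_nonneg (by positivity)]
        simp⟩
    simpa using ((IsPolyO.zpow n).mul h1).mul htr
  obtain ⟨C, N, hC, hbound⟩ := (hf₁.norm.add hf₂.norm).add hf₃.norm
  refine ⟨C, N, min c₁ c₂, hC, lt_min hc₁ hc₂, fun z hz hz1 ξ => ?_⟩
  have hb := hbound z hz hz1 ξ
  beta_reduce at hb
  rw [← Complex.ofReal_add, ← Complex.ofReal_add, Complex.norm_real,
    Real.norm_of_nonneg (by positivity)] at hb
  refine le_trans ?_ (mul_le_mul_of_nonneg_right hb (Real.exp_nonneg _))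
  have hsum : ∑ k ∈ Finset.range n, (z : ℂ) ^ k *
      (evalReal (expansionPoly l a J k) ξ * Complex.exp (-evalReal P ξ)) =
      truncEval F n z ξ * Complex.exp (-evalReal P ξ) := by
    rw [truncEval, Finset.sum_mul]
    refine Finset.sum_congr rfl fun k hk => ?_
    rw [expansionPoly_eq l a J (Finset.mem_range.1 hk), evalReal]
    ring
  have hexpP : ‖Complex.exp (-evalReal P ξ)‖ ≤ Real.exp (-(min c₁ c₂ * ‖ξ‖ ^ l)) := by
    refine norm_exp_neg_le (le_trans ?_ (hPc ξ))
    gcongr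
    exact min_le_right _ _
  rw [expansionRemainder, hsum]
  by_cases hξ : ξ ∈ z⁻¹ • piCube d
  · rw [Set.indicator_of_mem hξ]
    rw [Set.mem_inv_smul_set_iff₀ hz.ne'] at hξ
    have hexpS : Real.exp (-(scaledSymbol l a z ξ).re) ≤ Real.exp (-(min c₁ c₂ * ‖ξ‖ ^ l)) := by
      refine Real.exp_le_exp.2 (neg_le_neg ?_)
      rw [scaledSymbol, ← Complex.ofReal_pow, ← Complex.ofReal_inv, Complex.re_ofReal_mul]
      have h1 := hell _ hξ
      rw [norm_smul, Real.norm_of_nonneg hz.le, mul_pow] at h1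
      rw [inv_mul_eq_div, le_div_iff₀ (by positivity)]
      calc min c₁ c₂ * ‖ξ‖ ^ l * z ^ l ≤ c₁ * ‖ξ‖ ^ l * z ^ l := by
            gcongr
            exact min_le_left _ _
        _ = c₁ * (z ^ l * ‖ξ‖ ^ l) := by ring
        _ ≤ _ := h1
    have hsplit : Complex.exp (-scaledSymbol l a z ξ) =
        Complex.exp (-evalReal P ξ) * Complex.exp (evalReal P ξ - scaledSymbol l a z ξ) := by
      rw [← Complex.exp_add]
      ring_nf
    have hrem := norm_exp_sub_sum_le n (evalReal P ξ - scaledSymbol l a z ξ)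
    -- The product equals `max(e^{-Re P}, e^{-Re S})`, and each ellipticity condition handles one of
    -- the two.
    have hmax : ‖Complex.exp (-evalReal P ξ)‖ *
        max 1 (Real.exp (evalReal P ξ - scaledSymbol l a z ξ).re) ≤
          Real.exp (-(min c₁ c₂ * ‖ξ‖ ^ l)) := by
      rw [mul_max_of_nonneg _ _ (norm_nonneg _), mul_one]
      refine max_le hexpP (le_trans (le_of_eq ?_) hexpS)
      rw [Complex.norm_exp, ← Real.exp_add, Complex.neg_re, Complex.sub_re]
      ring_nf
    have hid : (-scaledSymbol l a z ξ) ^ J * Complex.exp (-scaledSymbol l a z ξ) -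
        truncEval F n z ξ * Complex.exp (-evalReal P ξ) =
        (-scaledSymbol l a z ξ) ^ J * (Complex.exp (-evalReal P ξ) *
          (Complex.exp (evalReal P ξ - scaledSymbol l a z ξ) -
            ∑ m ∈ Finset.range n, ((m.factorial : ℂ)⁻¹) *
              (evalReal P ξ - scaledSymbol l a z ξ) ^ m)) +
        ((-scaledSymbol l a z ξ) ^ J * ∑ m ∈ Finset.range n, ((m.factorial : ℂ)⁻¹) *
          (evalReal P ξ - scaledSymbol l a z ξ) ^ m - truncEval F n z ξ) *
            Complex.exp (-evalReal P ξ) := by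
      rw [hsplit]
      ring
    rw [hid]
    refine (norm_add_le _ _).trans ?_
    rw [norm_mul, norm_mul, norm_mul, add_mul, add_mul]
    refine le_add_of_le_of_nonneg (add_le_add ?_ ?_) (by positivity)
    · calc _ ≤ ‖(-scaledSymbol l a z ξ) ^ J‖ * (‖Complex.exp (-evalReal P ξ)‖ *
            (‖evalReal P ξ - scaledSymbol l a z ξ‖ ^ n *
              max 1 (Real.exp (evalReal P ξ - scaledSymbol l a z ξ).re))) := by gcongr
        _ = ‖(-scaledSymbol l a z ξ) ^ J * (evalReal P ξ - scaledSymbol l a z ξ) ^ n‖ *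
            (‖Complex.exp (-evalReal P ξ)‖ *
              max 1 (Real.exp (evalReal P ξ - scaledSymbol l a z ξ).re)) := by
            rw [norm_mul, norm_pow (_ - _)]
            ring
        _ ≤ _ := by gcongr
    · gcongr
  · rw [Set.indicator_of_notMem hξ, zero_sub, norm_neg, norm_mul]
    rw [Set.mem_inv_smul_set_iff₀ hz.ne', mem_piCube_iff] at hξ
    push Not at hξ
    obtain ⟨k, hk⟩ := hξ
    have h1 : 1 ≤ z * (1 + ‖ξ‖) := by
      have h2 : |(z • ξ) k| ≤ z * ‖ξ‖ := by
        rw [Pi.smul_apply, smul_eq_mul, abs_mul, abs_of_pos hz]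
        gcongr
        exact norm_le_pi_norm ξ k
      nlinarith [Real.pi_gt_three]
    have h2 : ‖truncEval F n z ξ‖ ≤
        ‖(z : ℂ) ^ n * ((1 + ‖ξ‖ : ℝ) : ℂ) ^ n * truncEval F n z ξ‖ := by
      rw [norm_mul, ← mul_pow, norm_pow, ← Complex.ofReal_mul, Complex.norm_real,
        Real.norm_of_nonneg (by positivity)]
      exact le_mul_of_one_le_left (norm_nonneg _) (one_le_pow₀ h1)
    gcongr
    refine h2.trans (le_add_of_nonneg_left (by positivity))

/-! ### Integration of the remainder -/

theorem continuous_scaledSymbol {d : ℕ} (l : ℕ) (a : MvPolynomial (Fin d × Bool) ℂ) (z : ℝ) :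
    Continuous (scaledSymbol l a z) := by
  unfold scaledSymbol
  fun_prop

theorem integral_expansionRemainder {d l : ℕ} (hl : 0 < l) {P : MvPolynomial (Fin d) ℂ}
    (hP : IsStronglyElliptic l P) (a : MvPolynomial (Fin d × Bool) ℂ) (J n : ℕ) (z : ℝ)
    (x : Fin d → ℝ) :
    ∫ ξ, expansionRemainder l a P J n z ξ * planeWave x ξ =
      (∫ ξ in z⁻¹ • piCube d, (-scaledSymbol l a z ξ) ^ J * Complex.exp (-scaledSymbol l a z ξ) *
        planeWave x ξ) -
      ∑ k ∈ Finset.range n, (z : ℂ) ^ k *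
        ∫ ξ, evalReal (expansionPoly l a J k) ξ * Complex.exp (-evalReal P ξ) * planeWave x ξ := by
  have hQ : IsCompact (z⁻¹ • piCube d) := (isCompact_piCube d).smul z⁻¹
  have hS := continuous_scaledSymbol l a z
  have hc : Continuous fun ξ => (-scaledSymbol l a z ξ) ^ J *
      Complex.exp (-scaledSymbol l a z ξ) * planeWave x ξ := by fun_prop
  have h1 : Integrable ((z⁻¹ • piCube d).indicator fun ξ => (-scaledSymbol l a z ξ) ^ J *
      Complex.exp (-scaledSymbol l a z ξ) * planeWave x ξ) :=
    (integrable_indicator_iff hQ.isClosed.measurableSet).2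
      (hc.continuousOn.integrableOn_compact hQ)
  have h2 : ∀ k ∈ Finset.range n, Integrable fun ξ => (z : ℂ) ^ k *
      (evalReal (expansionPoly l a J k) ξ * Complex.exp (-evalReal P ξ) * planeWave x ξ) :=
    fun k _ => ((integrable_evalReal_mul_exp hl hP _).mul_planeWave x).const_mul _
  rw [← integral_indicator hQ.isClosed.measurableSet]
  simp only [← integral_const_mul]
  rw [← integral_finsetSum _ h2, ← integral_sub h1 (integrable_finsetSum _ h2)]
  congr 1
  funext ξ
  rw [expansionRemainder, sub_mul, Finset.sum_mul]
  congr 1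
  · by_cases hξ : ξ ∈ z⁻¹ • piCube d
    · simp [hξ]
    · simp [hξ]
  · exact Finset.sum_congr rfl fun k _ => by ring

theorem exists_norm_integral_expansionRemainder_le {d l M : ℕ} (hl : 0 < l) (hM : 0 < M)
    {P : MvPolynomial (Fin d) ℂ} (hP : IsStronglyElliptic l P)
    {a : MvPolynomial (Fin d × Bool) ℂ} (h : IsApproximation l a P M)
    (ha₀ : MvPolynomial.coeff 0 a = 0) (ha : IsDiscreteElliptic a) (J n : ℕ) (z₁ : ℝ) :
    ∃ R : ℝ, 0 ≤ R ∧ ∀ z, 0 < z → z ≤ z₁ → ∀ x : Fin d → ℝ,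
      ‖∫ ξ, expansionRemainder l a P J n z ξ * planeWave x ξ‖ ≤ z ^ n * R := by
  obtain ⟨C, N, c, hC, hc, hbound⟩ :=
    exists_norm_expansionRemainder_le hl hM hP h ha₀ ha J n z₁
  have hi : Integrable fun ξ : Fin d → ℝ =>
      C * (1 + ‖ξ‖) ^ N * Real.exp (-(c * ‖ξ‖ ^ l)) :=
    integrable_of_norm_le_pow_mul_exp (by fun_prop) hc hl hC (N := N) fun ξ => by
      rw [Real.norm_of_nonneg (by positivity)]
  refine ⟨∫ ξ : Fin d → ℝ, C * (1 + ‖ξ‖) ^ N * Real.exp (-(c * ‖ξ‖ ^ l)),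
    integral_nonneg fun ξ => by positivity, fun z hz hz1 x => ?_⟩
  rw [← integral_const_mul]
  refine norm_integral_le_of_norm_le (hi.const_mul _) (Filter.Eventually.of_forall fun ξ => ?_)
  rw [norm_mul, norm_planeWave, mul_one]
  exact (hbound z hz hz1 ξ).trans_eq (by ring)

theorem cubeCoeff_eq_integral_smul {d : ℕ} (g : (Fin d → ℝ) → ℂ) (s : Fin d → ℤ) {z : ℝ}
    (hz : 0 < z) :
    cubeCoeff g s = (z : ℂ) ^ d *
      ∫ ξ in z⁻¹ • piCube d, g (z • ξ) * planeWave (z • intPoint s) ξ := by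
  have h := Measure.setIntegral_comp_smul_of_pos (volume : Measure (Fin d → ℝ))
    (fun θ => g θ * planeWave (intPoint s) θ) (z⁻¹ • piCube d) hz
  rw [smul_inv_smul₀ hz.ne'] at h
  simp only [planeWave_smul, Module.finrank_fin_fun] at h
  have hz0 : (z : ℂ) ^ d ≠ 0 := pow_ne_zero _ (by exact_mod_cast hz.ne')
  rw [h, Complex.real_smul, cubeCoeff, Complex.ofReal_inv, Complex.ofReal_pow,
    mul_inv_cancel_left₀ hz0]

/-- The derivatives of the Green function in the variables `z = ε t^{-1/l}`, `τ = t^{1/l}`. -/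
theorem iteratedDeriv_greenFunction_eq {d l : ℕ} (a : MvPolynomial (Fin d × Bool) ℂ) {ε τ : ℝ}
    (hε : 0 < ε) (hτ : 0 < τ) (s : Fin d → ℤ) (J : ℕ) :
    iteratedDeriv J (greenFunction l a ε s) (τ ^ l) =
      (((τ ^ d * (τ ^ l) ^ J)⁻¹ : ℝ) : ℂ) * (((2 * Real.pi : ℝ) : ℂ)⁻¹ ^ d *
        ∫ ξ in (ε / τ)⁻¹ • piCube d, (-scaledSymbol l a (ε / τ) ξ) ^ J *
          Complex.exp (-scaledSymbol l a (ε / τ) ξ) * planeWave ((ε / τ) • intPoint s) ξ) := by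
  have hz : 0 < ε / τ := by positivity
  have hε0 : (ε : ℂ) ≠ 0 := by exact_mod_cast hε.ne'
  have hτ0 : (τ : ℂ) ≠ 0 := by exact_mod_cast hτ.ne'
  rw [iteratedDeriv_greenFunction]
  beta_reduce
  rw [cubeCoeff_eq_integral_smul _ s hz]
  have h1 : ∀ ξ : Fin d → ℝ, (((ε ^ l)⁻¹ : ℝ) : ℂ) * discreteSymbol a ((ε / τ) • ξ) =
      ((τ : ℂ) ^ l)⁻¹ * scaledSymbol l a (ε / τ) ξ := by
    intro ξ
    rw [scaledSymbol]
    push_cast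
    rw [div_pow]
    field_simp
  have h2 : ∀ x : ℂ, (((τ ^ l : ℝ)) : ℂ) * -(((τ : ℂ) ^ l)⁻¹ * x) = -x := by
    intro x
    push_cast
    field_simp
  have h3 : ∀ ξ : Fin d → ℝ, (-(((τ : ℂ) ^ l)⁻¹ * scaledSymbol l a (ε / τ) ξ)) ^ J *
      Complex.exp (-scaledSymbol l a (ε / τ) ξ) * planeWave ((ε / τ) • intPoint s) ξ =
      (((τ : ℂ) ^ l) ^ J)⁻¹ * ((-scaledSymbol l a (ε / τ) ξ) ^ J *
        Complex.exp (-scaledSymbol l a (ε / τ) ξ) * planeWave ((ε / τ) • intPoint s) ξ) := by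
    intro ξ
    rw [← mul_neg, mul_pow, inv_pow]
    ring
  simp only [h1, h2, h3]
  rw [integral_const_mul]
  generalize (∫ ξ in (ε / τ)⁻¹ • piCube d, (-scaledSymbol l a (ε / τ) ξ) ^ J *
    Complex.exp (-scaledSymbol l a (ε / τ) ξ) * planeWave ((ε / τ) • intPoint s) ξ) = I
  push_cast
  rw [div_pow]
  field_simp

end

/-! ### Rescaling and conclusion. -/

noncomputable section

open scoped Pointwise

/-! ### The expansion of the Green function -/

theorem exists_expansion_bound {d l M : ℕ} (hl : 0 < l) (hM : 0 < M)
    {P : MvPolynomial (Fin d) ℂ} (hP : IsStronglyElliptic l P)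
    {a : MvPolynomial (Fin d × Bool) ℂ} (h : IsApproximation l a P M)
    (ha₀ : MvPolynomial.coeff 0 a = 0) (ha : IsDiscreteElliptic a) (K J : ℕ) {t₀ : ℝ}
    (ht₀ : 0 < t₀) :
    ∃ R : ℝ, 0 ≤ R ∧ ∀ ε τ : ℝ, 0 < ε → 0 < τ → t₀ * ε ^ l ≤ τ ^ l → ∀ s : Fin d → ℤ,
      ‖iteratedDeriv J (greenFunction l a ε s) (τ ^ l) -
        ∑ k ∈ Finset.range (K + 1), ((ε ^ k / (τ ^ (k + d) * (τ ^ l) ^ J) : ℝ) : ℂ) *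
          expansionTerm l a P J k (τ⁻¹ • gridPoint ε s)‖ ≤
        ε ^ (K + 1) * R / (τ ^ (K + d + 1) * (τ ^ l) ^ J) := by
  obtain ⟨R, hR, hbound⟩ := exists_norm_integral_expansionRemainder_le hl hM hP h ha₀ ha J (K + 1)
    -- The time restriction says `z^l ≤ 1/t₀`; either `z ≤ 1` or `z ≤ z^l`, so no root of `t₀` is
    -- needed.
    (max 1 t₀⁻¹)
  refine ⟨(2 * Real.pi)⁻¹ ^ d * R, by positivity, fun ε τ hε hτ ht s => ?_⟩
  have hτ0 : (τ : ℂ) ≠ 0 := by exact_mod_cast hτ.ne'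
  set z := ε / τ
  have hz : 0 < z := by positivity
  have hz1 : z ≤ max 1 t₀⁻¹ := by
    rcases le_total z 1 with h1 | h1
    · exact h1.trans (le_max_left _ _)
    · refine ((le_self_pow₀ h1 hl.ne').trans ?_).trans (le_max_right _ _)
      rw [div_pow, div_le_iff₀ (by positivity), inv_mul_eq_div, le_div_iff₀ ht₀]
      linarith
  have hpoint : (τ⁻¹ • gridPoint ε s).ofLp = z • intPoint s := by
    ext i
    simp only [gridPoint, intPoint, PiLp.smul_apply, Pi.smul_apply, smul_eq_mul, z]
    ring
  have hmain : iteratedDeriv J (greenFunction l a ε s) (τ ^ l) -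
        ∑ k ∈ Finset.range (K + 1), ((ε ^ k / (τ ^ (k + d) * (τ ^ l) ^ J) : ℝ) : ℂ) *
          expansionTerm l a P J k (τ⁻¹ • gridPoint ε s) =
      (((τ ^ d * (τ ^ l) ^ J)⁻¹ : ℝ) : ℂ) * (((2 * Real.pi : ℝ) : ℂ)⁻¹ ^ d *
        ∫ ξ, expansionRemainder l a P J (K + 1) z ξ * planeWave (z • intPoint s) ξ) := by
    rw [iteratedDeriv_greenFunction_eq a hε hτ, integral_expansionRemainder hl hP, mul_sub, mul_sub]
    congr 1
    rw [Finset.mul_sum, Finset.mul_sum]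
    refine Finset.sum_congr rfl fun k _ => ?_
    rw [expansionTerm_eq_profileIntegral hl hP, profileIntegral, hpoint]
    have h1 : ((ε ^ k / (τ ^ (k + d) * (τ ^ l) ^ J) : ℝ) : ℂ) =
        (((τ ^ d * (τ ^ l) ^ J)⁻¹ : ℝ) : ℂ) * (z : ℂ) ^ k := by
      rw [← Complex.ofReal_pow, ← Complex.ofReal_mul]
      congr 1
      simp only [z, div_pow, pow_add]
      field_simp
    rw [h1]
    ring
  rw [hmain, norm_mul, norm_mul, Complex.norm_real, Real.norm_of_nonneg (by positivity), norm_pow,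
    norm_inv, Complex.norm_real, Real.norm_of_nonneg (by positivity)]
  calc _ ≤ (τ ^ d * (τ ^ l) ^ J)⁻¹ * ((2 * Real.pi)⁻¹ ^ d * (z ^ (K + 1) * R)) := by
        gcongr
        exact hbound z hz hz1 _
    _ = _ := by
        simp only [z, div_pow, pow_add]
        field_simp

theorem theorem1 (d : ℕ) (hd : 0 < d) (l lmax M : ℕ) (hl : 0 < l) (hl_even : Even l)
    (hlmax : l ≤ lmax) (hM : 0 < M)
    (P : MvPolynomial (Fin d) ℂ) (hP : P.IsHomogeneous l) (hP_ell : IsStronglyElliptic l P)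
    (a : MvPolynomial (Fin d × Bool) ℂ)
    (ha : ∀ ν ∈ a.support, l ≤ ν.degree ∧ ν.degree ≤ lmax)
    (ha_approx : IsApproximation l a P M) (ha_ell : IsDiscreteElliptic a) :
    -- the continuous profile and the terms of the expansion
    ContDiff ℝ ∞ (greenProfile P) ∧
    (∀ J : ℕ, expansionTerm l a P J 0 = (fun f => -diffOp P f)^[J] (greenProfile P)) ∧
    (∀ J k : ℕ, 0 < k → k < M → expansionTerm l a P J k = 0) ∧
    -- the first discrete Green function exists, is unique and is smooth in time
    (∀ ε : ℝ, 0 < ε → ∃ u : (Fin d → ℤ) → ℝ → ℂ, IsFirstGreen l a ε u ∧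
      (∀ s, ContDiffOn ℝ ∞ (u s) (Set.Ici 0)) ∧
      ∀ v : (Fin d → ℤ) → ℝ → ℂ, IsFirstGreen l a ε v →
        ∀ s, ∀ t : ℝ, 0 ≤ t → v s t = u s t) ∧
    -- the expansion with a uniform bound of the remainder
    ∀ K J : ℕ, M ≤ K → ∀ t₀ : ℝ, 0 < t₀ → ∃ R : ℝ, 0 ≤ R ∧
      ∀ ε : ℝ, 0 < ε → ∀ u : (Fin d → ℤ) → ℝ → ℂ, IsFirstGreen l a ε u →
        ∀ s : Fin d → ℤ, ∀ t : ℝ, t₀ * ε ^ l ≤ t →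
          ‖iteratedDeriv J (u s) t -
            ∑ k ∈ Finset.range (K + 1),
              ((ε ^ k / t ^ (((k : ℝ) + d) / l + J) : ℝ) : ℂ) *
                expansionTerm l a P J k ((t ^ (1 / (l : ℝ)))⁻¹ • gridPoint ε s)‖
            ≤ ε ^ (K + 1) * R / t ^ (((K : ℝ) + d + 1) / l + J) := by
  -- Every monomial has degree at least `l > 0`; this gives `A(0) = 0`.
  have ha₀ : MvPolynomial.coeff 0 a = 0 := by
    by_contra h
    have := (ha 0 (MvPolynomial.mem_support_iff.2 h)).1
    simp only [map_zero] at this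
    omega
  refine ⟨contDiff_greenProfile hl hP_ell, fun J => ?_, fun J k hk hkM => ?_, fun ε _ =>
    ⟨greenFunction l a ε, isFirstGreen_greenFunction hd l a ε,
      fun s => (contDiff_greenFunction l a ε s).contDiffOn,
      fun v hv s t ht => (isFirstGreen_greenFunction hd l a ε).eq hv s ht⟩,
    fun K J _ t₀ ht₀ => ?_⟩
  · rw [expansionTerm_eq_profileIntegral hl hP_ell, iterate_neg_diffOp_greenProfile hl hP_ell,
      expansionPoly_zero hM ha_approx]
  · rw [expansionTerm_eq_profileIntegral hl hP_ell, expansionPoly_eq_zero hM ha_approx J hk hkM]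
    funext y
    simp [profileIntegral, evalReal]
  · obtain ⟨R, hR, hbound⟩ :=
      exists_expansion_bound hl hM hP_ell ha_approx ha₀ ha_ell K J ht₀
    refine ⟨R, hR, fun ε hε u hu s t ht => ?_⟩
    have htpos : 0 < t := lt_of_lt_of_le (by positivity) ht
    set τ := t ^ (1 / (l : ℝ))
    have hτ : 0 < τ := Real.rpow_pos_of_pos htpos _
    have hl' : (l : ℝ) ≠ 0 := by exact_mod_cast hl.ne'
    have htτ : τ ^ l = t := by
      rw [← Real.rpow_natCast, ← Real.rpow_mul htpos.le, one_div_mul_cancel hl', Real.rpow_one]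
    have hpow : ∀ (m : ℕ), t ^ ((m : ℝ) / l + J) = τ ^ m * (τ ^ l) ^ J := by
      intro m
      rw [Real.rpow_add htpos, htτ, Real.rpow_natCast, ← Real.rpow_natCast τ, ← Real.rpow_mul htpos.le]
      congr 2
      ring
    -- Uniqueness identifies the functions for nonnegative times only. As `t > 0`, that covers a
    -- neighbourhood of `t`, so all derivatives agree.
    have hu' : iteratedDeriv J (u s) t = iteratedDeriv J (greenFunction l a ε s) t := by
      refine Filter.EventuallyEq.iteratedDeriv_eq J ?_
      filter_upwards [Ioi_mem_nhds htpos] with r hr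
      exact (isFirstGreen_greenFunction hd l a ε).eq hu s (le_of_lt hr)
    have hpow₁ : ∀ k : ℕ, t ^ (((k : ℝ) + d) / l + J) = τ ^ (k + d) * (τ ^ l) ^ J := fun k => by
      rw [← hpow]
      push_cast
      rfl
    have hpow₂ : t ^ (((K : ℝ) + d + 1) / l + J) = τ ^ (K + d + 1) * (τ ^ l) ^ J := by
      rw [← hpow]
      push_cast
      rfl
    have key := hbound ε τ hε hτ (htτ ▸ ht) s
    simp only [hpow₁, hpow₂, hu']
    rwa [← htτ]

end
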